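/- Let $(\mathscr C,\mathbb E,\mathfrak s)$ be an extriangulated category in the sense of Nakaoka–Palu (with $\mathscr C$ additive), let $\mathbb E^i$ ($i\ge 1$) be its higher positive extension groups ($\mathbb E^1=\mathbb E$, $\mathbb E^{i+1}=\mathbb E^i\otimes_{\mathscr C}\mathbb E$, i.e. $\mathbb E^{i+1}(C,A)=\int^{X}\mathbb E^i(X,A)\otimes\mathbb E(C,X)$), let $d\ge 1$ be an integer, and let $\mathcal M\subseteq\mathscr C$ be an additive full subcategory (closed under isomorphisms and finite direct sums) that is $d$-rigid: $\mathbb E^i(M,M')=0$ for all $M,M'\in\mathcal M$ and $1\le i\le d$. Notation. For $t\ge 0$ let $\mathcal M^t$ be the class of objects $X$ with an $\mathbb E$-triangle sequence $X\to X_0\to X_1\to\cdots\to X_t\to 0$ with all $X_i\in\mathcal M$; that is, $\mathcal M^0=\mathcal M$, and $X\in\mathcal M^{t+1}$ if there is an $\mathbb E$-triangle $X\to X_0\to K\dashrightarrow$ with $X_0\in\mathcal M$ and $K\in\mathcal M^{t}$. Dually, $\mathcal M_t$ is the class of objects $X$ with an $\mathbb E$-triangle sequence $0\to Y_t\to\cdots\to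 Y_0\to X$ with all $Y_i\in\mathcal M$. Let $K_0^{\rm sp}(\mathcal M)$ be the split Grothendieck group: the free abelian group on isomorphism classes $[M]$ of objects of $\mathcal M$, modulo the relations $[M\oplus M']=[M]+[M']$. For $X\in\mathcal M^t$ (resp. $X\in\mathcal M_t$) with $t\le d$, put $$\operatorname{ind}^L_{\mathcal M}(X)=\sum_{i=0}^t(-1)^i[X_i],\qquad \operatorname{ind}^R_{\mathcal M}(X)=\sum_{i=0}^t(-1)^i[Y_i]\qquad\text{in }K_0^{\rm sp}(\mathcal M).$$ Let $F_{\mathcal M}(X)=\operatorname{Hom}(-,X)|_{\mathcal M}$ and $G_{\mathcal M}(X)=\operatorname{Hom}(X,-)|_{\mathcal M}$. Let $\operatorname{Im}(\mathbb E(?,-)|_{\mathcal M})$ be the class of functors $\mathcal M\to\mathrm{Ab}$ isomorphic to $\mathbb E(S,-)|_{\mathcal M}$ for some $S\in\mathcal M^d\cap\mathcal M_1$, and let $\operatorname{Im}(\mathbb E(-,?)|_{\mathcal M})$ be the class of functors $\mathcal M^{\rm op}\to\mathrm{Ab}$ isomorphic to $\mathbb E(-,S)|_{\mathcal M}$ for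 some $S\in\mathcal M_d\cap\mathcal M^1$. Put $$\Psi(\mathbb E(S,-)|_{\mathcal M})=\operatorname{ind}^L_{\mathcal M}(S)-\operatorname{ind}^R_{\mathcal M}(S),\qquad \Phi(\mathbb E(-,S)|_{\mathcal M})=\operatorname{ind}^R_{\mathcal M}(S)-\operatorname{ind}^L_{\mathcal M}(S).$$ Proposition. The indices $\operatorname{ind}^L_{\mathcal M}$ and $\operatorname{ind}^R_{\mathcal M}$ do not depend on the chosen sequences (nor on their length $t\le d$), and $\Psi$ and $\Phi$ are well defined on isomorphism classes of functors, independently of the chosen $S$. Moreover, for every $\mathbb E$-triangle $A\xrightarrow{f}B\xrightarrow{g}C\dashrightarrow$ in $\mathscr C$: (1) If $A,B,C\in\mathcal M^d$, then $\operatorname{coker}(G_{\mathcal M}(f))\in\operatorname{Im}(\mathbb E(?,-)|_{\mathcal M})$ and $$\operatorname{ind}^L_{\mathcal M}(A)-\operatorname{ind}^L_{\mathcal M}(B)+\operatorname{ind}^L_{\mathcal M}(C)=\Psi(\operatorname{coker}(G_{\mathcal M}(f))).$$ (2) If $A,B,C\in\mathcal M_d$, then $\operatorname{coker}(F_{\mathcal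 M}(g))\in\operatorname{Im}(\mathbb E(-,?)|_{\mathcal M})$ and $$\operatorname{ind}^R_{\mathcal M}(A)-\operatorname{ind}^R_{\mathcal M}(B)+\operatorname{ind}^R_{\mathcal M}(C)=\Phi(\operatorname{coker}(F_{\mathcal M}(g))).$$ -/

import Mathlib

open CategoryTheory CategoryTheory.Limits Opposite

universe v u

noncomputable section

namespace Extri

section Bifunctor

variable {C : Type u} [Category.{v} C]

/-- The group `E(Z, A)` of extensions, for a bifunctor `E : Cᵒᵖ × C → Ab`. -/
abbrev Ext (E : Cᵒᵖ ⥤ C ⥤ AddCommGrpCat.{v}) (Z A : C) : Type v :=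
  (E.obj (op Z)).obj A

/-- The pushforward `a_* δ` of an extension `δ ∈ E(Z, A)` along `a : A ⟶ A₁`. -/
def push (E : Cᵒᵖ ⥤ C ⥤ AddCommGrpCat.{v}) {Z A A₁ : C} (a : A ⟶ A₁) :
    Ext E Z A →+ Ext E Z A₁ :=
  ((E.obj (op Z)).map a).hom

/-- The pullback `c^* δ` of an extension `δ ∈ E(Z, A)` along `c : Z₁ ⟶ Z`. -/
def pull (E : Cᵒᵖ ⥤ C ⥤ AddCommGrpCat.{v}) {Z Z₁ A : C} (c : Z₁ ⟶ Z) :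
    Ext E Z A →+ Ext E Z₁ A :=
  ((E.map c.op).app A).hom

end Bifunctor

/-- The structure of an extriangulated category (Nakaoka--Palu) on an additive category `C`: an
additive bifunctor `E : Cᵒᵖ × C → Ab` and an additive realization `𝔰` of it, subject to (ET3),
(ET3)ᵒᵖ, (ET4) and (ET4)ᵒᵖ. The realization is recorded by the predicate `IsTriangle x y δ`,
which says that `A --x--> B --y--> Z` belongs to the class `𝔰(δ)`, where `δ ∈ E(Z, A)`; the first
three fields after it say that `𝔰(δ)` is exactly one equivalence class of sequences, two sequences
`A ⟶ B ⟶ Z` and `A ⟶ B₁ ⟶ Z` being equivalent if there is an isomorphism `B ≅ B₁` compatible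
with the identities of `A` and `Z`. -/
structure Extriangulation (C : Type u) [Category.{v} C] [Preadditive C] [HasZeroObject C]
    [HasBinaryBiproducts C] where
  /-- the bifunctor of extensions, contravariant in the first variable -/
  E : Cᵒᵖ ⥤ C ⥤ AddCommGrpCat.{v}
  /-- additivity in the first variable -/
  additive_left : E.Additive
  /-- additivity in the second variable -/
  additive_right : ∀ Z : Cᵒᵖ, (E.obj Z).Additive
  /-- `A --x--> B --y--> Z` realizes `δ` -/
  IsTriangle : ∀ {A B Z : C}, (A ⟶ B) → (B ⟶ Z) → Ext E Z A → Prop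
  /-- every extension is realized by some sequence -/
  exists_triangle : ∀ {A Z : C} (δ : Ext E Z A),
    ∃ (B : C) (x : A ⟶ B) (y : B ⟶ Z), IsTriangle x y δ
  /-- two sequences that realize the same extension are equivalent -/
  equiv_of_triangle : ∀ {A B B₁ Z : C} {x : A ⟶ B} {y : B ⟶ Z} {x₁ : A ⟶ B₁} {y₁ : B₁ ⟶ Z}
    {δ : Ext E Z A}, IsTriangle x y δ → IsTriangle x₁ y₁ δ →
      ∃ b : B ≅ B₁, x ≫ b.hom = x₁ ∧ b.hom ≫ y₁ = y
  /-- a sequence that is equivalent to a realization of `δ` realizes `δ` -/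
  triangle_of_equiv : ∀ {A B B₁ Z : C} {x : A ⟶ B} {y : B ⟶ Z} {x₁ : A ⟶ B₁} {y₁ : B₁ ⟶ Z}
    {δ : Ext E Z A} (b : B ≅ B₁), x ≫ b.hom = x₁ → b.hom ≫ y₁ = y →
      IsTriangle x y δ → IsTriangle x₁ y₁ δ
  /-- a morphism of extensions is realized by a morphism of sequences -/
  realize_hom : ∀ {A B Z A₁ B₁ Z₁ : C} {x : A ⟶ B} {y : B ⟶ Z} {δ : Ext E Z A}
    {x₁ : A₁ ⟶ B₁} {y₁ : B₁ ⟶ Z₁} {δ₁ : Ext E Z₁ A₁} (a : A ⟶ A₁) (c : Z ⟶ Z₁),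
      IsTriangle x y δ → IsTriangle x₁ y₁ δ₁ → push E a δ = pull E c δ₁ →
      ∃ b : B ⟶ B₁, x ≫ b = a ≫ x₁ ∧ y ≫ c = b ≫ y₁
  /-- the zero extension is realized by the split sequence -/
  zero_triangle : ∀ A Z : C,
    IsTriangle (biprod.inl : A ⟶ A ⊞ Z) (biprod.snd : A ⊞ Z ⟶ Z) (0 : Ext E Z A)
  /-- the direct sum of realizations realizes the direct sum of extensions -/
  biprod_triangle : ∀ {A B Z A₁ B₁ Z₁ : C} {x : A ⟶ B} {y : B ⟶ Z} {δ : Ext E Z A}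
    {x₁ : A₁ ⟶ B₁} {y₁ : B₁ ⟶ Z₁} {δ₁ : Ext E Z₁ A₁},
      IsTriangle x y δ → IsTriangle x₁ y₁ δ₁ →
      IsTriangle (biprod.map x x₁) (biprod.map y y₁)
        (push E biprod.inl (pull E biprod.fst δ) + push E biprod.inr (pull E biprod.snd δ₁) :
          Ext E (Z ⊞ Z₁) (A ⊞ A₁))
  /-- (ET3) -/
  et3 : ∀ {A B Z A₁ B₁ Z₁ : C} {x : A ⟶ B} {y : B ⟶ Z} {δ : Ext E Z A}
    {x₁ : A₁ ⟶ B₁} {y₁ : B₁ ⟶ Z₁} {δ₁ : Ext E Z₁ A₁} (a : A ⟶ A₁) (b : B ⟶ B₁),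
      IsTriangle x y δ → IsTriangle x₁ y₁ δ₁ → x ≫ b = a ≫ x₁ →
      ∃ c : Z ⟶ Z₁, y ≫ c = b ≫ y₁ ∧ push E a δ = pull E c δ₁
  /-- (ET3)ᵒᵖ -/
  et3_op : ∀ {A B Z A₁ B₁ Z₁ : C} {x : A ⟶ B} {y : B ⟶ Z} {δ : Ext E Z A}
    {x₁ : A₁ ⟶ B₁} {y₁ : B₁ ⟶ Z₁} {δ₁ : Ext E Z₁ A₁} (b : B ⟶ B₁) (c : Z ⟶ Z₁),
      IsTriangle x y δ → IsTriangle x₁ y₁ δ₁ → y ≫ c = b ≫ y₁ →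
      ∃ a : A ⟶ A₁, x ≫ b = a ≫ x₁ ∧ push E a δ = pull E c δ₁
  /-- (ET4) -/
  et4 : ∀ {A B D Z F : C} {f : A ⟶ B} {f₁ : B ⟶ D} {δ : Ext E D A}
    {g : B ⟶ Z} {g₁ : Z ⟶ F} {δ₁ : Ext E F B},
      IsTriangle f f₁ δ → IsTriangle g g₁ δ₁ →
      ∃ (Q : C) (h₁ : Z ⟶ Q) (d : D ⟶ Q) (e : Q ⟶ F) (δ₂ : Ext E Q A),
        IsTriangle (f ≫ g) h₁ δ₂ ∧ f₁ ≫ d = g ≫ h₁ ∧ h₁ ≫ e = g₁ ∧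
        IsTriangle d e (push E f₁ δ₁) ∧ pull E d δ₂ = δ ∧ push E f δ₂ = pull E e δ₁
  /-- (ET4)ᵒᵖ -/
  et4_op : ∀ {A B D Z F : C} {f₁ : D ⟶ A} {f : A ⟶ B} {δ : Ext E B D}
    {g₁ : F ⟶ B} {g : B ⟶ Z} {δ₁ : Ext E Z F},
      IsTriangle f₁ f δ → IsTriangle g₁ g δ₁ →
      ∃ (Q : C) (h₁ : Q ⟶ A) (d : D ⟶ Q) (e : Q ⟶ F) (δ₂ : Ext E Z Q),
        IsTriangle h₁ (f ≫ g) δ₂ ∧ d ≫ h₁ = f₁ ∧ e ≫ g₁ = h₁ ≫ f ∧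
        IsTriangle d e (pull E g₁ δ) ∧ push E e δ₂ = δ₁ ∧ push E d δ = pull E g δ₂

section HigherExtensions

/-! Higher positive extensions (Gorsky--Nakaoka--Palu): `E¹ = E` and `Eⁿ⁺¹ = Eⁿ ⊗_C E`, that is
`Eⁿ⁺¹(Z, A) = ∫^X Eⁿ(X, A) ⊗ E(Z, X)`, the coend of abelian groups. -/

variable {C : Type u} [Category.{v} C]

/-- The relations that define `∫^X F(X) ⊗ E(Z, X)` as a quotient of the free abelian group on the
symbols `(X, ξ, δ)` with `ξ ∈ F(X)` and `δ ∈ E(Z, X)`. -/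
inductive CoendRel (E : Cᵒᵖ ⥤ C ⥤ AddCommGrpCat.{v}) (F : Cᵒᵖ ⥤ AddCommGrpCat.{max u v}) (Z : C) :
    FreeAbelianGroup (Σ X : C, F.obj (op X) × Ext E Z X) → Prop
  | add_left (X : C) (ξ₁ ξ₂ : F.obj (op X)) (δ : Ext E Z X) :
      CoendRel E F Z (FreeAbelianGroup.of ⟨X, ξ₁ + ξ₂, δ⟩ - FreeAbelianGroup.of ⟨X, ξ₁, δ⟩
        - FreeAbelianGroup.of ⟨X, ξ₂, δ⟩)
  | add_right (X : C) (ξ : F.obj (op X)) (δ₁ δ₂ : Ext E Z X) :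
      CoendRel E F Z (FreeAbelianGroup.of ⟨X, ξ, δ₁ + δ₂⟩ - FreeAbelianGroup.of ⟨X, ξ, δ₁⟩
        - FreeAbelianGroup.of ⟨X, ξ, δ₂⟩)
  | balance (X Y : C) (a : X ⟶ Y) (ξ : F.obj (op Y)) (δ : Ext E Z X) :
      CoendRel E F Z (FreeAbelianGroup.of ⟨X, (F.map a.op).hom ξ, δ⟩
        - FreeAbelianGroup.of ⟨Y, ξ, push E a δ⟩)

/-- The abelian group `∫^X F(X) ⊗ E(Z, X)`. -/
abbrev Coend (E : Cᵒᵖ ⥤ C ⥤ AddCommGrpCat.{v}) (F : Cᵒᵖ ⥤ AddCommGrpCat.{max u v}) (Z : C) :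
    Type (max u v) :=
  FreeAbelianGroup (Σ X : C, F.obj (op X) × Ext E Z X) ⧸
    AddSubgroup.closure {r | CoendRel E F Z r}

/-- The map `F ⊗ E(Z, -) → F ⊗ E(Z₁, -)` induced by `c : Z₁ ⟶ Z`; it sends the class of
`(X, ξ, δ)` to the class of `(X, ξ, c^* δ)`. -/
def Coend.map (E : Cᵒᵖ ⥤ C ⥤ AddCommGrpCat.{v}) (F : Cᵒᵖ ⥤ AddCommGrpCat.{max u v}) {Z Z₁ : C}
    (c : Z₁ ⟶ Z) : Coend E F Z →+ Coend E F Z₁ :=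
  QuotientAddGroup.map _ _
    (FreeAbelianGroup.map fun s : (Σ X : C, F.obj (op X) × Ext E Z X) =>
      (⟨s.1, s.2.1, pull E c s.2.2⟩ : Σ X : C, F.obj (op X) × Ext E Z₁ X)) (by
    rw [AddSubgroup.closure_le]
    rintro r hr
    refine AddSubgroup.subset_closure ?_
    cases hr with
    | add_left X ξ₁ ξ₂ δ =>
      simp only [map_sub, FreeAbelianGroup.map_of_apply]
      exact CoendRel.add_left X ξ₁ ξ₂ _
    | add_right X ξ δ₁ δ₂ =>
      simp only [map_sub, FreeAbelianGroup.map_of_apply, map_add]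
      exact CoendRel.add_right X ξ _ _
    | balance X Y a ξ δ =>
      have h : pull E c (push E a δ) = push E a (pull E c δ) :=
        (ConcreteCategory.congr_hom ((E.map c.op).naturality a) δ)
      simp only [map_sub, FreeAbelianGroup.map_of_apply, h]
      exact CoendRel.balance X Y a ξ _)

/-- The functor `F ⊗_C E : Z ↦ ∫^X F(X) ⊗ E(Z, X)`. -/
def tensorExt (E : Cᵒᵖ ⥤ C ⥤ AddCommGrpCat.{v}) (F : Cᵒᵖ ⥤ AddCommGrpCat.{max u v}) :
    Cᵒᵖ ⥤ AddCommGrpCat.{max u v} where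
  obj Z := AddCommGrpCat.of (Coend E F Z.unop)
  map c := AddCommGrpCat.ofHom (Coend.map E F c.unop)
  map_id Z := by
    ext s
    change (QuotientAddGroup.mk (FreeAbelianGroup.map _ (FreeAbelianGroup.of s)) :
      Coend E F Z.unop) = QuotientAddGroup.mk (FreeAbelianGroup.of s)
    rw [FreeAbelianGroup.map_of_apply]
    simp [pull]
  map_comp c₁ c₂ := by
    ext s
    change (QuotientAddGroup.mk (FreeAbelianGroup.map _ (FreeAbelianGroup.of s)) : Coend E F _) =
      QuotientAddGroup.mk (FreeAbelianGroup.map _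
        (FreeAbelianGroup.map _ (FreeAbelianGroup.of s)))
    simp only [FreeAbelianGroup.map_of_apply]
    simp [pull]

/-- `higherExt E A n` is the functor `Eⁿ(-, A)`; here `E⁰ = Hom`, `E¹ = E`, and
`Eⁿ⁺¹ = Eⁿ ⊗_C E` for `n ≥ 1`. -/
def higherExt [Preadditive C] (E : Cᵒᵖ ⥤ C ⥤ AddCommGrpCat.{v}) (A : C) :
    ℕ → (Cᵒᵖ ⥤ AddCommGrpCat.{max u v})
  | 0 => preadditiveYoneda.obj A ⋙ AddCommGrpCat.uliftFunctor.{u, v}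
  | 1 => E.flip.obj A ⋙ AddCommGrpCat.uliftFunctor.{u, v}
  | n + 2 => tensorExt E (higherExt E A (n + 1))

end HigherExtensions

section Subcategories

variable {C : Type u} [Category.{v} C]

/-- A full subcategory that is closed under isomorphisms and finite direct sums. -/
structure IsAdditiveSubcategory [Preadditive C] [HasBinaryBiproducts C] (M : ObjectProperty C) :
    Prop where
  of_iso : ∀ {X Y : C}, (X ≅ Y) → M X → M Y
  of_isZero : ∀ {X : C}, IsZero X → M X
  biprod : ∀ {X Y : C}, M X → M Y → M (X ⊞ Y)

/-- The free abelian group on the isomorphism classes of objects of `M`. -/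
abbrev FreeIsoClasses (M : ObjectProperty C) : Type u :=
  FreeAbelianGroup (Quotient (isIsomorphicSetoid M.FullSubcategory))

/-- The generator `[X]` of the free abelian group on isomorphism classes. -/
def isoClass (M : ObjectProperty C) (X : M.FullSubcategory) : FreeIsoClasses M :=
  FreeAbelianGroup.of (Quotient.mk (isIsomorphicSetoid M.FullSubcategory) X)

/-- The split Grothendieck group of `M`: the quotient of the free abelian group on isomorphism
classes by the elements `[X ⊕ Y] - [X] - [Y]`. -/
abbrev SplitK0 [Preadditive C] [HasBinaryBiproducts C] (M : ObjectProperty C) : Type u :=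
  FreeIsoClasses M ⧸ AddSubgroup.closure
    {r : FreeIsoClasses M | ∃ X Y S : M.FullSubcategory, Nonempty (S.obj ≅ X.obj ⊞ Y.obj) ∧
      r = isoClass M S - isoClass M X - isoClass M Y}

/-- The class `[X]` in the split Grothendieck group. -/
def SplitK0.mk [Preadditive C] [HasBinaryBiproducts C] (M : ObjectProperty C) (X : C) (hX : M X) :
    SplitK0 M :=
  QuotientAddGroup.mk (isoClass M ⟨X, hX⟩)

end Subcategories

namespace Extriangulation

variable {C : Type u} [Category.{v} C] [Preadditive C] [HasZeroObject C] [HasBinaryBiproducts C]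
variable (𝔼 : Extriangulation C) (M : ObjectProperty C)

/-- `M` is `d`-rigid: `Eⁱ(M, M) = 0` for `1 ≤ i ≤ d`. -/
def IsRigid (d : ℕ) : Prop :=
  ∀ i, 1 ≤ i → i ≤ d → ∀ X Y : C, M X → M Y → Subsingleton ((higherExt 𝔼.E Y i).obj (op X))

/-- A left filtration `X ⟶ X₀ ⟶ ⋯ ⟶ Xₜ ⟶ 0` of length `t` with all `Xᵢ` in `M`: for `t = 0` it
is an isomorphism `X ≅ X₀` (a triangle whose third term is `0`), and a filtration of length
`t + 1` is a triangle `X ⟶ X₀ ⟶ K ⇢` together with a filtration of length `t` of `K`. -/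
inductive LeftFiltration : ℕ → C → Type (max u v)
  | zero {X X₀ : C} (hX₀ : M X₀) (e : X ≅ X₀) : LeftFiltration 0 X
  | succ {t : ℕ} {X X₀ K : C} (hX₀ : M X₀) (x : X ⟶ X₀) (y : X₀ ⟶ K) (δ : Ext 𝔼.E K X)
      (tri : 𝔼.IsTriangle x y δ) (G : LeftFiltration t K) : LeftFiltration (t + 1) X

/-- A right filtration `0 ⟶ Yₜ ⟶ ⋯ ⟶ Y₀ ⟶ X` of length `t` with all `Yᵢ` in `M`. -/
inductive RightFiltration : ℕ → C → Type (max u v)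
  | zero {X Y₀ : C} (hY₀ : M Y₀) (e : Y₀ ≅ X) : RightFiltration 0 X
  | succ {t : ℕ} {X Y₀ P : C} (hY₀ : M Y₀) (x : P ⟶ Y₀) (y : Y₀ ⟶ X) (δ : Ext 𝔼.E X P)
      (tri : 𝔼.IsTriangle x y δ) (G : RightFiltration t P) : RightFiltration (t + 1) X

variable {𝔼 M}

/-- The alternating sum `∑ (-1)ⁱ [Xᵢ]` of a left filtration. -/
def LeftFiltration.altSum : {t : ℕ} → {X : C} → 𝔼.LeftFiltration M t X → SplitK0 M
  | _, _, .zero (X₀ := X₀) hX₀ _ => SplitK0.mk M X₀ hX₀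
  | _, _, .succ (X₀ := X₀) hX₀ _ _ _ _ G => SplitK0.mk M X₀ hX₀ - G.altSum

/-- The alternating sum `∑ (-1)ⁱ [Yᵢ]` of a right filtration. -/
def RightFiltration.altSum : {t : ℕ} → {X : C} → 𝔼.RightFiltration M t X → SplitK0 M
  | _, _, .zero (Y₀ := Y₀) hY₀ _ => SplitK0.mk M Y₀ hY₀
  | _, _, .succ (Y₀ := Y₀) hY₀ _ _ _ _ G => SplitK0.mk M Y₀ hY₀ - G.altSum

variable (𝔼 M)

/-- The subcategory `Mᵗ` of objects with a left filtration of length `t`. -/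
def upper (t : ℕ) : ObjectProperty C := fun X => Nonempty (𝔼.LeftFiltration M t X)

/-- The subcategory `Mₜ` of objects with a right filtration of length `t`. -/
def lower (t : ℕ) : ObjectProperty C := fun X => Nonempty (𝔼.RightFiltration M t X)

variable {𝔼 M}

/-- The left index of an object of `Mᵗ`, computed from a chosen left filtration of length `t`. -/
def leftIndex {t : ℕ} {X : C} (hX : 𝔼.upper M t X) : SplitK0 M :=
  (Classical.choice hX).altSum

/-- The right index of an object of `Mₜ`, computed from a chosen right filtration of length `t`. -/
def rightIndex {t : ℕ} {X : C} (hX : 𝔼.lower M t X) : SplitK0 M :=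
  (Classical.choice hX).altSum

variable (𝔼 M)

/-- The functor `F_M : X ↦ Hom(-, X)|_M`. -/
def homTo : C ⥤ M.FullSubcategoryᵒᵖ ⥤ AddCommGrpCat.{v} :=
  preadditiveYoneda ⋙ (Functor.whiskeringLeft _ _ _).obj M.ι.op

/-- The (contravariant) functor `G_M : X ↦ Hom(X, -)|_M`. -/
def homFrom : Cᵒᵖ ⥤ M.FullSubcategory ⥤ AddCommGrpCat.{v} :=
  preadditiveCoyoneda ⋙ (Functor.whiskeringLeft _ _ _).obj M.ι

/-- The right `M`-module `E(-, X)|_M`. -/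
def extTo (X : C) : M.FullSubcategoryᵒᵖ ⥤ AddCommGrpCat.{v} :=
  M.ι.op ⋙ 𝔼.E.flip.obj X

/-- The left `M`-module `E(X, -)|_M`. -/
def extFrom (X : C) : M.FullSubcategory ⥤ AddCommGrpCat.{v} :=
  M.ι ⋙ 𝔼.E.obj (op X)

/-- The image of `E(?, -)|_M : Mᵈ ∩ M₁ → mod Mᵒᵖ`, closed under isomorphism. -/
def imExtFrom (d : ℕ) : ObjectProperty (M.FullSubcategory ⥤ AddCommGrpCat.{v}) := fun N =>
  ∃ S : C, 𝔼.upper M d S ∧ 𝔼.lower M 1 S ∧ Nonempty (N ≅ 𝔼.extFrom M S)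

/-- The image of `E(-, ?)|_M : M_d ∩ M¹ → mod M`, closed under isomorphism. -/
def imExtTo (d : ℕ) : ObjectProperty (M.FullSubcategoryᵒᵖ ⥤ AddCommGrpCat.{v}) := fun N =>
  ∃ S : C, 𝔼.lower M d S ∧ 𝔼.upper M 1 S ∧ Nonempty (N ≅ 𝔼.extTo M S)

variable {𝔼 M}

/-- `Ψ : E(S, -)|_M ↦ ind^L(S) - ind^R(S)`, computed from a chosen `S` in `Mᵈ ∩ M₁`. -/
def Psi {d : ℕ} {N : M.FullSubcategory ⥤ AddCommGrpCat.{v}} (hN : 𝔼.imExtFrom M d N) :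
    SplitK0 M :=
  leftIndex hN.choose_spec.1 - rightIndex hN.choose_spec.2.1

/-- `Φ : E(-, S)|_M ↦ ind^R(S) - ind^L(S)`, computed from a chosen `S` in `M_d ∩ M¹`. -/
def Phi {d : ℕ} {N : M.FullSubcategoryᵒᵖ ⥤ AddCommGrpCat.{v}} (hN : 𝔼.imExtTo M d N) :
    SplitK0 M :=
  rightIndex hN.choose_spec.1 - leftIndex hN.choose_spec.2.1

end Extriangulation

end Extri

end

/-!
The proof works with the exactness properties of triangles, and reduces everything to the vanishing
`E(K, M) = 0` for `K ∈ Mᵗ`, `t < d` (`Extri.Extriangulation.LeftVanishing`), and its dual.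

*Vanishing.* For an additive half exact functor `F : Cᵒᵖ ⥤ Ab`, the functor `F ⊗ E` is the first satellite of
`F`: for a triangle `X ⟶ Y ⟶ Z` realizing `δ`, a tensor `ξ ⊗ δ` vanishes in `(F ⊗ E)(Z)` exactly if
`ξ` extends to `Y` (`HalfExact.exists_of_tmul_eq_zero`), because the coend maps to the directed
colimit, over all extensions of `Z`, of the cokernels of `F(Y) ⟶ F(X)`. Moreover `F ⊗ E` is again
half exact. So all higher extension functors have the expected exactness in the first variable, and
dimension shifting along a left filtration of `K` gives `Eⁱ(K, M) = 0` for `i + t ≤ d`.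

*Independence and additivity.* With this vanishing, Schanuel's lemma shows that the left index does
not depend on the filtration (`HasLeftIndex.unique`), and the horseshoe lemma shows that `Mᵗ⁺¹` is
closed under extensions of objects of `Mᵗ` by objects of `Mᵗ⁺¹`, with additive index
(`HasLeftIndex.extension`).

*`Ψ` is well defined* (`HasLeftIndex.sub_eq_of_natural`). An isomorphism `E(S, -) ≅ E(S₁, -)` on `M`
is induced by a morphism `S₁ ⟶ S`. Let `T` be the cone of `S₁ ⟶ S ⊞ X₀`, where `S₁ ⟶ X₀` is the
first step of a left filtration of `S₁`. Then `E(T, M) = 0`, the left index of `T` is the difference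
of those of `S ⊞ X₀` and `S₁`, and all triangles that compare `T` with the right filtrations of `S`
and `S₁` split.

*The formula* (`IsTriangle.exists_leftIndex`). For a triangle `A ⟶ B ⟶ Z` and the first step
`A ⟶ A₀` of a left filtration, let `P` be the pushout of `B` and `A₀`, let `P ⟶ P₀` be the first
step of a left filtration of `P`, and let `S` be the cone of `A₀ ⟶ P₀`. Then `E(S, -)` is the image
of `Hom(A, -) ⟶ E(Z, -)` on `M`, which is the cokernel of `Hom(B, -) ⟶ Hom(A, -)`.

*Duality.* The statements on right indices follow by passing to the opposite extriangulated
category (`Extriangulation.opposite`). Since `Eⁿ⁺¹ = Eⁿ ⊗ E` is not visibly self-dual, the rigidity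
of the opposite subcategory needs an argument: reading chains of extensions backwards is a
surjection from `Eⁿ(Z, A)` to the corresponding group of the opposite category
(`reverse_surjective`).
-/

namespace Extri

/-! ### Functoriality of the bifunctor of extensions -/

section Bifunctor

variable {C : Type u} [Category.{v} C] (E : Cᵒᵖ ⥤ C ⥤ AddCommGrpCat.{v})

@[simp]
theorem push_id {Z A : C} (δ : Ext E Z A) : push E (𝟙 A) δ = δ := by simp [push]

@[simp]
theorem pull_id {Z A : C} (δ : Ext E Z A) : pull E (𝟙 Z) δ = δ := by simp [pull]

theorem push_comp {Z A A₁ A₂ : C} (a : A ⟶ A₁) (b : A₁ ⟶ A₂) (δ : Ext E Z A) :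
    push E (a ≫ b) δ = push E b (push E a δ) := by simp [push]

theorem pull_comp {Z Z₁ Z₂ A : C} (c : Z₂ ⟶ Z₁) (c₁ : Z₁ ⟶ Z) (δ : Ext E Z A) :
    pull E (c ≫ c₁) δ = pull E c (pull E c₁ δ) := by simp [pull]

theorem pull_push {Z Z₁ A A₁ : C} (c : Z₁ ⟶ Z) (a : A ⟶ A₁) (δ : Ext E Z A) :
    pull E c (push E a δ) = push E a (pull E c δ) :=
  ConcreteCategory.congr_hom ((E.map c.op).naturality a) δ

theorem push_hom_inv {Z A A₁ : C} (e : A ≅ A₁) (δ : Ext E Z A) :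
    push E e.inv (push E e.hom δ) = δ := by
  rw [← push_comp, e.hom_inv_id, push_id]

theorem pull_inv_hom {Z Z₁ A : C} (e : Z ≅ Z₁) (δ : Ext E Z₁ A) :
    pull E e.inv (pull E e.hom δ) = δ := by
  rw [← pull_comp, e.inv_hom_id, pull_id]

end Bifunctor

namespace Extriangulation

variable {C : Type u} [Category.{v} C] [Preadditive C] [HasZeroObject C] [HasBinaryBiproducts C]
variable (𝔼 : Extriangulation C)

section Additivity

variable {Z Z₁ A A₁ : C}

theorem push_add_hom (a b : A ⟶ A₁) (δ : Ext 𝔼.E Z A) :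
    push 𝔼.E (a + b) δ = push 𝔼.E a δ + push 𝔼.E b δ := by
  have := 𝔼.additive_right (op Z)
  simp [push, Functor.map_add]

theorem pull_add_hom (a b : Z₁ ⟶ Z) (δ : Ext 𝔼.E Z A) :
    pull 𝔼.E (a + b) δ = pull 𝔼.E a δ + pull 𝔼.E b δ := by
  have := 𝔼.additive_left
  simp [pull, Functor.map_add]

@[simp]
theorem push_zero_hom (δ : Ext 𝔼.E Z A) : push 𝔼.E (0 : A ⟶ A₁) δ = 0 := by
  have := 𝔼.push_add_hom (0 : A ⟶ A₁) 0 δ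
  simpa using this

@[simp]
theorem pull_zero_hom (δ : Ext 𝔼.E Z A) : pull 𝔼.E (0 : Z₁ ⟶ Z) δ = 0 := by
  have := 𝔼.pull_add_hom (0 : Z₁ ⟶ Z) 0 δ
  simpa using this

theorem push_neg_hom (a : A ⟶ A₁) (δ : Ext 𝔼.E Z A) :
    push 𝔼.E (-a) δ = - push 𝔼.E a δ := by
  rw [eq_neg_iff_add_eq_zero, ← push_add_hom]; simp

/-- An extension by a biproduct in the first variable is determined by its two restrictions. -/
theorem eq_fst_add_snd (δ : Ext 𝔼.E (Z ⊞ Z₁) A) :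
    δ = pull 𝔼.E biprod.fst (pull 𝔼.E biprod.inl δ) +
      pull 𝔼.E biprod.snd (pull 𝔼.E biprod.inr δ) := by
  rw [← pull_comp, ← pull_comp, ← pull_add_hom, biprod.total, pull_id]

end Additivity

/-! ### Exactness properties of triangles -/

theorem triangle_id_zero {A O : C} (hO : IsZero O) :
    𝔼.IsTriangle (𝟙 A) (0 : A ⟶ O) (0 : Ext 𝔼.E O A) :=
  𝔼.triangle_of_equiv (b := ⟨biprod.fst, biprod.inl, by
      ext <;> simp [hO.eq_of_src (biprod.inr : O ⟶ A ⊞ O) 0], by simp⟩) (by simp)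
    (hO.eq_of_tgt _ _) (𝔼.zero_triangle A O)

theorem triangle_zero_id {Z O : C} (hO : IsZero O) :
    𝔼.IsTriangle (0 : O ⟶ Z) (𝟙 Z) (0 : Ext 𝔼.E Z O) :=
  𝔼.triangle_of_equiv (b := ⟨biprod.snd, biprod.inr, by
      ext <;> simp [hO.eq_of_src (biprod.inl : O ⟶ O ⊞ Z) 0], by simp⟩) (hO.eq_of_src _ _)
    (by simp) (𝔼.zero_triangle O Z)

theorem zero_triangle_inr (A Z : C) :
    𝔼.IsTriangle (biprod.inr : Z ⟶ A ⊞ Z) biprod.fst (0 : Ext 𝔼.E A Z) :=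
  𝔼.triangle_of_equiv (biprod.braiding Z A) (by ext <;> simp) (by simp) (𝔼.zero_triangle Z A)

variable {𝔼}

section Exactness

variable {A B Z W : C} {x : A ⟶ B} {y : B ⟶ Z} {δ : Ext 𝔼.E Z A}

theorem IsTriangle.comp_eq_zero (h : 𝔼.IsTriangle x y δ) : x ≫ y = 0 := by
  obtain ⟨c, hc, -⟩ := 𝔼.et3 (𝟙 A) x (𝔼.triangle_id_zero (A := A) (isZero_zero C)) h rfl
  rw [← hc, zero_comp]

theorem IsTriangle.exists_desc (h : 𝔼.IsTriangle x y δ) (n : B ⟶ W) (hn : x ≫ n = 0) :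
    ∃ k : Z ⟶ W, y ≫ k = n := by
  obtain ⟨c, hc, -⟩ := 𝔼.et3 0 n h (𝔼.triangle_zero_id (Z := W) (isZero_zero C)) (by simpa using hn)
  exact ⟨c, by simpa using hc⟩

theorem IsTriangle.push_eq_zero (h : 𝔼.IsTriangle x y δ) : push 𝔼.E x δ = 0 := by
  obtain ⟨c, -, hc⟩ := 𝔼.et3 x (𝟙 B) h (𝔼.triangle_id_zero (A := B) (isZero_zero C)) (by simp)
  simpa using hc

theorem IsTriangle.pull_eq_zero (h : 𝔼.IsTriangle x y δ) : pull 𝔼.E y δ = 0 := by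
  obtain ⟨c, -, hc⟩ := 𝔼.et3_op (𝟙 B) y (𝔼.triangle_zero_id (Z := B) (isZero_zero C)) h (by simp)
  simpa using hc.symm

theorem IsTriangle.exists_extension (h : 𝔼.IsTriangle x y δ) (a : A ⟶ W)
    (ha : push 𝔼.E a δ = 0) : ∃ b : B ⟶ W, x ≫ b = a := by
  obtain ⟨b, hb, -⟩ := 𝔼.realize_hom a 0 h (𝔼.triangle_id_zero (A := W) (isZero_zero C))
    (by simpa using ha)
  exact ⟨b, by simpa using hb⟩

theorem IsTriangle.exists_coextension (h : 𝔼.IsTriangle x y δ) (c : W ⟶ Z)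
    (hc : pull 𝔼.E c δ = 0) : ∃ b : W ⟶ B, b ≫ y = c := by
  obtain ⟨b, -, hb⟩ := 𝔼.realize_hom 0 c (𝔼.triangle_zero_id (Z := W) (isZero_zero C)) h
    (by simpa using hc.symm)
  exact ⟨b, by simpa using hb.symm⟩

/-- Exactness of `Hom(A, W) ⟶ E(Z, W) ⟶ E(B, W)`. -/
theorem IsTriangle.exists_push_eq (h : 𝔼.IsTriangle x y δ) (ε : Ext 𝔼.E Z W)
    (hε : pull 𝔼.E y ε = 0) : ∃ a : A ⟶ W, push 𝔼.E a δ = ε := by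
  obtain ⟨N, m, n, hN⟩ := 𝔼.exists_triangle ε
  obtain ⟨b, hb⟩ := hN.exists_coextension y hε
  obtain ⟨a, -, ha⟩ := 𝔼.et3_op b (𝟙 Z) h hN (by simp [hb])
  exact ⟨a, by simpa using ha⟩

/-- Exactness of `Hom(W, Z) ⟶ E(W, A) ⟶ E(W, B)`. -/
theorem IsTriangle.exists_pull_eq (h : 𝔼.IsTriangle x y δ) (ε : Ext 𝔼.E W A)
    (hε : push 𝔼.E x ε = 0) : ∃ c : W ⟶ Z, pull 𝔼.E c δ = ε := by
  obtain ⟨N, m, n, hN⟩ := 𝔼.exists_triangle ε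
  obtain ⟨b, hb⟩ := hN.exists_extension x hε
  obtain ⟨c, -, hc⟩ := 𝔼.et3 (𝟙 A) b hN h (by simp [hb])
  exact ⟨c, by simpa using hc.symm⟩

/-- Exactness of `E(Z, W) ⟶ E(B, W) ⟶ E(A, W)`. -/
theorem IsTriangle.exists_pull_eq_of_pull_eq_zero (h : 𝔼.IsTriangle x y δ) (β : Ext 𝔼.E B W)
    (hβ : pull 𝔼.E x β = 0) : ∃ ε : Ext 𝔼.E Z W, pull 𝔼.E y ε = β := by
  obtain ⟨Y, m, n, hY⟩ := 𝔼.exists_triangle β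
  obtain ⟨Q, h₁, d, e, δ₂, -, -, -, hQ, -, h6⟩ := 𝔼.et4_op hY h
  obtain ⟨r, hr⟩ := hQ.exists_extension (𝟙 W) (by simpa using hβ)
  refine ⟨push 𝔼.E r δ₂, ?_⟩
  rw [pull_push, ← h6, ← push_comp, hr, push_id]

end Exactness

/-! ### Transport of triangles along isomorphisms -/

/-- An endomorphism of the middle term of a triangle that induces the identity of both ends is of
the form `1 + n` with `n² = 0`. -/
theorem IsTriangle.isIso_of_endo {A B Z : C} {x : A ⟶ B} {y : B ⟶ Z} {δ : Ext 𝔼.E Z A}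
    (h : 𝔼.IsTriangle x y δ) (b : B ⟶ B) (hx : x ≫ b = x) (hy : b ≫ y = y) : IsIso b := by
  obtain ⟨k, hk⟩ := h.exists_desc (b - 𝟙 B) (by simp [hx])
  have hn : (b - 𝟙 B) ≫ y = 0 := by simp [hy]
  have h2 : (b - 𝟙 B) ≫ (b - 𝟙 B) = 0 := by
    calc (b - 𝟙 B) ≫ (b - 𝟙 B) = (b - 𝟙 B) ≫ y ≫ k := by rw [hk]
      _ = 0 := by rw [← Category.assoc, hn, zero_comp]
  have h3 : b ≫ b = b + b - 𝟙 B := by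
    simp only [Preadditive.sub_comp, Preadditive.comp_sub, Category.comp_id,
      Category.id_comp] at h2
    rw [← sub_eq_zero, ← h2]; abel
  refine ⟨⟨𝟙 B + 𝟙 B - b, ?_, ?_⟩⟩
  · simp only [Preadditive.comp_sub, Preadditive.comp_add, Category.comp_id, h3]; abel
  · simp only [Preadditive.sub_comp, Preadditive.add_comp, Category.id_comp, h3]; abel

/-- A morphism of triangles that is invertible on both ends is invertible in the middle. -/
theorem IsTriangle.isIso_middle {A B Z A₁ B₁ Z₁ : C} {x : A ⟶ B} {y : B ⟶ Z} {δ : Ext 𝔼.E Z A}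
    {x₁ : A₁ ⟶ B₁} {y₁ : B₁ ⟶ Z₁} {δ₁ : Ext 𝔼.E Z₁ A₁} (h : 𝔼.IsTriangle x y δ)
    (h₁ : 𝔼.IsTriangle x₁ y₁ δ₁) (a : A ≅ A₁) (c : Z ≅ Z₁) (b : B ⟶ B₁)
    (hx : x ≫ b = a.hom ≫ x₁) (hy : y ≫ c.hom = b ≫ y₁)
    (hδ : push 𝔼.E a.hom δ = pull 𝔼.E c.hom δ₁) : IsIso b := by
  obtain ⟨b', hx', hy'⟩ := 𝔼.realize_hom a.inv c.inv h₁ h (by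
    have := congrArg (fun t => push 𝔼.E a.inv (pull 𝔼.E c.inv t)) hδ
    simp only [pull_push, pull_inv_hom, push_hom_inv] at this
    rw [← this])
  have i1 : IsIso (b ≫ b') := h.isIso_of_endo _
    (by rw [← Category.assoc, hx, Category.assoc, hx', ← Category.assoc, a.hom_inv_id,
      Category.id_comp])
    (by rw [Category.assoc, ← hy', ← Category.assoc, ← hy, Category.assoc, c.hom_inv_id,
      Category.comp_id])
  have i2 : IsIso (b' ≫ b) := h₁.isIso_of_endo _
    (by rw [← Category.assoc, hx', Category.assoc, hx, ← Category.assoc, a.inv_hom_id,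
      Category.id_comp])
    (by rw [Category.assoc, ← hy, ← Category.assoc, ← hy', Category.assoc, c.inv_hom_id,
      Category.comp_id])
  have : IsSplitMono b := IsSplitMono.mk' ⟨b' ≫ inv (b ≫ b'), by
    rw [← Category.assoc, IsIso.hom_inv_id]⟩
  have : Epi b := epi_of_epi_fac (f := b') (h := b' ≫ b) rfl
  exact isIso_of_epi_of_isSplitMono b

/-- A sequence isomorphic to a triangle is a triangle for the transported extension. -/
theorem IsTriangle.of_iso {A B Z A₁ B₁ Z₁ : C} {x : A ⟶ B} {y : B ⟶ Z} {δ : Ext 𝔼.E Z A}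
    {x₁ : A₁ ⟶ B₁} {y₁ : B₁ ⟶ Z₁} {δ₁ : Ext 𝔼.E Z₁ A₁} (h : 𝔼.IsTriangle x y δ)
    (a : A ≅ A₁) (b : B ≅ B₁) (c : Z ≅ Z₁)
    (hx : x ≫ b.hom = a.hom ≫ x₁) (hy : y ≫ c.hom = b.hom ≫ y₁)
    (hδ : push 𝔼.E a.hom δ = pull 𝔼.E c.hom δ₁) : 𝔼.IsTriangle x₁ y₁ δ₁ := by
  obtain ⟨B₂, x₂, y₂, h₂⟩ := 𝔼.exists_triangle δ₁
  obtain ⟨b₂, hx₂, hy₂⟩ := 𝔼.realize_hom a.hom c.hom h h₂ hδ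
  have := h.isIso_middle h₂ a c b₂ hx₂ hy₂ hδ
  refine 𝔼.triangle_of_equiv ((asIso b₂).symm ≪≫ b) ?_ ?_ h₂
  · rw [← cancel_epi a.hom]
    simp only [Iso.trans_hom, Iso.symm_hom, asIso_inv, ← hx]
    rw [← Category.assoc, ← hx₂]; simp
  · rw [← cancel_epi b₂]
    simp [← hy, hy₂]

theorem IsTriangle.of_iso_left {A B Z A₁ : C} {x : A ⟶ B} {y : B ⟶ Z} {δ : Ext 𝔼.E Z A}
    (h : 𝔼.IsTriangle x y δ) (a : A ≅ A₁) :
    𝔼.IsTriangle (a.inv ≫ x) y (push 𝔼.E a.hom δ) :=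
  h.of_iso a (Iso.refl _) (Iso.refl _) (by simp) (by simp) (by simp)

theorem IsTriangle.of_iso_middle {A B Z B₁ : C} {x : A ⟶ B} {y : B ⟶ Z} {δ : Ext 𝔼.E Z A}
    (h : 𝔼.IsTriangle x y δ) (b : B ≅ B₁) :
    𝔼.IsTriangle (x ≫ b.hom) (b.inv ≫ y) δ :=
  𝔼.triangle_of_equiv b rfl (by simp) h

/-- A triangle realizing the zero extension splits. -/
theorem IsTriangle.nonempty_iso_biprod {A B Z : C} {x : A ⟶ B} {y : B ⟶ Z} {δ : Ext 𝔼.E Z A}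
    (h : 𝔼.IsTriangle x y δ) (hδ : δ = 0) : Nonempty (B ≅ A ⊞ Z) := by
  subst hδ
  obtain ⟨b, -⟩ := 𝔼.equiv_of_triangle h (𝔼.zero_triangle A Z)
  exact ⟨b⟩

theorem IsTriangle.biprod_left {A B Z : C} {x : A ⟶ B} {y : B ⟶ Z} {δ : Ext 𝔼.E Z A}
    (h : 𝔼.IsTriangle x y δ) (D : C) :
    𝔼.IsTriangle (biprod.map (𝟙 D) x) (biprod.snd ≫ y : D ⊞ B ⟶ Z)
      (push 𝔼.E biprod.inr δ : Ext 𝔼.E Z (D ⊞ A)) :=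
  (𝔼.biprod_triangle (𝔼.triangle_id_zero (A := D) (isZero_zero C)) h).of_iso (Iso.refl _)
    (Iso.refl _) ⟨biprod.snd, biprod.inr,
      biprod.hom_ext' _ _ ((isZero_zero C).eq_of_src _ _) (by simp), by simp⟩
    (by simp) (by simp) (by simp [pull_push])

/-- `D ⊞ -` applied to the last two terms of a triangle. -/
theorem IsTriangle.biprod_right {A B Z : C} {x : A ⟶ B} {y : B ⟶ Z} {δ : Ext 𝔼.E Z A}
    (h : 𝔼.IsTriangle x y δ) (D : C) :
    𝔼.IsTriangle (x ≫ biprod.inl : A ⟶ B ⊞ D) (biprod.map y (𝟙 D))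
      (pull 𝔼.E biprod.fst δ : Ext 𝔼.E (Z ⊞ D) A) :=
  (𝔼.biprod_triangle h (𝔼.triangle_zero_id (Z := D) (isZero_zero C))).of_iso
    ⟨biprod.fst, biprod.inl,
      biprod.hom_ext' _ _ (by simp) ((isZero_zero C).eq_of_src _ _), by simp⟩
    (Iso.refl _) (Iso.refl _)
    (biprod.hom_ext' _ _ (by simp) ((isZero_zero C).eq_of_src _ _)) (by simp)
    (by simp [← push_comp])

/-! ### Mapping cones, pushouts and pullbacks -/

/-- The mapping cone of a morphism `a : A ⟶ A₁` out of the first term of a triangle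
`A ⟶ B ⟶ Z`. -/
theorem IsTriangle.exists_cone {A B Z A₁ : C} {x : A ⟶ B} {y : B ⟶ Z} {δ : Ext 𝔼.E Z A}
    (h : 𝔼.IsTriangle x y δ) (a : A ⟶ A₁) :
    ∃ (Q : C) (q : A₁ ⊞ B ⟶ Q) (e : Q ⟶ Z),
      𝔼.IsTriangle (biprod.lift a x) q (pull 𝔼.E e δ) ∧
      𝔼.IsTriangle (-(biprod.inl ≫ q)) e (push 𝔼.E a δ) := by
  -- `(a, 1)` is a split inflation with deflation `(-1, a)`
  have hs : 𝔼.IsTriangle (biprod.lift a (𝟙 A)) (biprod.desc (-𝟙 A₁) a)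
      (0 : Ext 𝔼.E A₁ A) := by
    refine (𝔼.zero_triangle A A₁).of_iso (Iso.refl _)
      ⟨biprod.desc (biprod.lift a (𝟙 A)) (-biprod.inl),
        biprod.lift biprod.snd (biprod.desc (-𝟙 A₁) a), ?_, ?_⟩ (Iso.refl _) ?_ ?_ ?_
    · ext <;> simp
    · ext <;> simp
    · simp
    · ext <;> simp
    · simp
  obtain ⟨Q, h₁, d, e, δ₂, ht, hd, -, hde, -, h6⟩ := 𝔼.et4 hs (h.biprod_left A₁)
  have hd' : d = -(biprod.inl ≫ h₁) := by
    have := congrArg (fun t => biprod.inl ≫ t) hd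
    simpa [neg_eq_iff_eq_neg] using this
  have h7 : δ₂ = pull 𝔼.E e δ := by
    have := congrArg (push 𝔼.E biprod.snd) h6
    rwa [← push_comp, ← pull_push, ← push_comp, biprod.lift_snd, biprod.inr_snd, push_id,
      push_id] at this
  subst h7
  have hl : biprod.lift a (𝟙 A) ≫ biprod.map (𝟙 A₁) x = biprod.lift a x := by ext <;> simp
  rw [hl] at ht
  refine ⟨Q, h₁, e, ht, ?_⟩
  rw [← hd']
  rwa [← push_comp, biprod.inr_desc] at hde

/-- The pushout of two triangles with the same first term. -/
theorem IsTriangle.exists_pushout {A B₁ Z₁ B₂ Z₂ : C} {x₁ : A ⟶ B₁} {y₁ : B₁ ⟶ Z₁}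
    {δ₁ : Ext 𝔼.E Z₁ A} {x₂ : A ⟶ B₂} {y₂ : B₂ ⟶ Z₂} {δ₂ : Ext 𝔼.E Z₂ A}
    (h₁ : 𝔼.IsTriangle x₁ y₁ δ₁) (h₂ : 𝔼.IsTriangle x₂ y₂ δ₂) :
    ∃ (P : C) (m₁ : B₁ ⟶ P) (e₁ : P ⟶ Z₂) (m₂ : B₂ ⟶ P) (e₂ : P ⟶ Z₁),
      𝔼.IsTriangle m₁ e₁ (push 𝔼.E x₁ δ₂) ∧ 𝔼.IsTriangle m₂ e₂ (push 𝔼.E x₂ δ₁) := by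
  obtain ⟨P, p, q, hP⟩ := 𝔼.exists_triangle
    (pull 𝔼.E biprod.fst δ₁ + pull 𝔼.E biprod.snd δ₂ : Ext 𝔼.E (Z₁ ⊞ Z₂) A)
  refine ⟨P, ?_⟩
  -- each half comes from (ET4)ᵒᵖ applied to `A ⟶ P ⟶ Z₁ ⊞ Z₂` and a split triangle
  obtain ⟨Q₁, k₁, d₁, e₁, ε₁, t₁, -, -, s₁, -, r₁⟩ := 𝔼.et4_op hP (𝔼.zero_triangle Z₁ Z₂)
  obtain ⟨Q₂, k₂, d₂, e₂, ε₂, t₂, -, -, s₂, -, r₂⟩ := 𝔼.et4_op hP (𝔼.zero_triangle_inr Z₁ Z₂)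
  have w₁ : pull 𝔼.E biprod.inl (pull 𝔼.E biprod.fst δ₁ + pull 𝔼.E biprod.snd δ₂ :
      Ext 𝔼.E (Z₁ ⊞ Z₂) A) = δ₁ := by simp [← pull_comp]
  have w₂ : pull 𝔼.E biprod.inr (pull 𝔼.E biprod.fst δ₁ + pull 𝔼.E biprod.snd δ₂ :
      Ext 𝔼.E (Z₁ ⊞ Z₂) A) = δ₂ := by simp [← pull_comp]
  rw [w₁] at s₁
  rw [w₂] at s₂
  obtain ⟨b₁, hb₁, -⟩ := 𝔼.equiv_of_triangle s₁ h₁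
  obtain ⟨b₂, hb₂, -⟩ := 𝔼.equiv_of_triangle s₂ h₂
  have u₁ := congrArg (pull 𝔼.E biprod.inr) r₁
  rw [pull_push, w₂, ← pull_comp, biprod.inr_snd, pull_id] at u₁
  have u₂ := congrArg (pull 𝔼.E biprod.inl) r₂
  rw [pull_push, w₁, ← pull_comp, biprod.inl_fst, pull_id] at u₂
  refine ⟨_, _, _, _, t₁.of_iso b₁ (Iso.refl _) (Iso.refl _) (x₁ := b₁.inv ≫ k₁) (by simp)
    (by simp; rfl) ?_, t₂.of_iso b₂ (Iso.refl _) (Iso.refl _) (x₁ := b₂.inv ≫ k₂) (by simp)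
    (by simp; rfl) ?_⟩
  · rw [← u₁, ← push_comp, hb₁]; simp
  · rw [← u₂, ← push_comp, hb₂]; simp

/-- The pullback of two triangles with the same last term. -/
theorem IsTriangle.exists_pullback {Z A₁ B₁ A₂ B₂ : C} {x₁ : A₁ ⟶ B₁} {y₁ : B₁ ⟶ Z}
    {δ₁ : Ext 𝔼.E Z A₁} {x₂ : A₂ ⟶ B₂} {y₂ : B₂ ⟶ Z} {δ₂ : Ext 𝔼.E Z A₂}
    (h₁ : 𝔼.IsTriangle x₁ y₁ δ₁) (h₂ : 𝔼.IsTriangle x₂ y₂ δ₂) :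
    ∃ (P : C) (m₁ : A₁ ⟶ P) (e₁ : P ⟶ B₂) (m₂ : A₂ ⟶ P) (e₂ : P ⟶ B₁),
      𝔼.IsTriangle m₁ e₁ (pull 𝔼.E y₂ δ₁) ∧ 𝔼.IsTriangle m₂ e₂ (pull 𝔼.E y₁ δ₂) := by
  obtain ⟨P, p, q, hP⟩ := 𝔼.exists_triangle
    (push 𝔼.E biprod.inl δ₁ + push 𝔼.E biprod.inr δ₂ : Ext 𝔼.E Z (A₁ ⊞ A₂))
  refine ⟨P, ?_⟩
  obtain ⟨Q₁, k₁, d₁, e₁, ε₁, t₁, -, -, s₁, -, r₁⟩ := 𝔼.et4 (𝔼.zero_triangle A₁ A₂) hP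
  obtain ⟨Q₂, k₂, d₂, e₂, ε₂, t₂, -, -, s₂, -, r₂⟩ := 𝔼.et4 (𝔼.zero_triangle_inr A₁ A₂) hP
  have w₁ : push 𝔼.E biprod.fst (push 𝔼.E biprod.inl δ₁ + push 𝔼.E biprod.inr δ₂ :
      Ext 𝔼.E Z (A₁ ⊞ A₂)) = δ₁ := by simp [← push_comp]
  have w₂ : push 𝔼.E biprod.snd (push 𝔼.E biprod.inl δ₁ + push 𝔼.E biprod.inr δ₂ :
      Ext 𝔼.E Z (A₁ ⊞ A₂)) = δ₂ := by simp [← push_comp]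
  rw [w₂] at s₁
  rw [w₁] at s₂
  obtain ⟨b₁, -, hb₁⟩ := 𝔼.equiv_of_triangle s₁ h₂
  obtain ⟨b₂, -, hb₂⟩ := 𝔼.equiv_of_triangle s₂ h₁
  have u₁ := congrArg (push 𝔼.E biprod.fst) r₁
  rw [← pull_push, w₁, ← push_comp, biprod.inl_fst, push_id] at u₁
  have u₂ := congrArg (push 𝔼.E biprod.snd) r₂
  rw [← pull_push, w₂, ← push_comp, biprod.inr_snd, push_id] at u₂
  refine ⟨_, _, _, _, t₁.of_iso (Iso.refl _) (Iso.refl _) b₁ (x₁ := biprod.inl ≫ p)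
    (y₁ := k₁ ≫ b₁.hom) (by simp) (by simp) ?_, t₂.of_iso (Iso.refl _) (Iso.refl _) b₂
    (x₁ := biprod.inr ≫ p) (y₁ := k₂ ≫ b₂.hom) (by simp) (by simp) ?_⟩
  · rw [u₁, ← pull_comp, hb₁]; simp
  · rw [u₂, ← pull_comp, hb₂]; simp

end Extriangulation

/-! ### The coend defining higher extensions -/

namespace Coend

variable {C : Type u} [Category.{v} C] {E : Cᵒᵖ ⥤ C ⥤ AddCommGrpCat.{v}}
variable {F : Cᵒᵖ ⥤ AddCommGrpCat.{max u v}} {Z : C}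

variable (E F) in
/-- The class in `∫^X F(X) ⊗ E(Z, X)` of the pure tensor `ξ ⊗ δ` at `X`. -/
noncomputable def tmul {Z X : C} (ξ : F.obj (op X)) (δ : Ext E Z X) : Coend E F Z :=
  QuotientAddGroup.mk (FreeAbelianGroup.of ⟨X, ξ, δ⟩)

theorem add_tmul {X : C} (ξ₁ ξ₂ : F.obj (op X)) (δ : Ext E Z X) :
    tmul E F (ξ₁ + ξ₂) δ = tmul E F ξ₁ δ + tmul E F ξ₂ δ := by
  rw [← sub_eq_zero, ← sub_sub]
  exact (QuotientAddGroup.eq_zero_iff _).2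
    (AddSubgroup.subset_closure (CoendRel.add_left X ξ₁ ξ₂ δ))

theorem tmul_add {X : C} (ξ : F.obj (op X)) (δ₁ δ₂ : Ext E Z X) :
    tmul E F ξ (δ₁ + δ₂) = tmul E F ξ δ₁ + tmul E F ξ δ₂ := by
  rw [← sub_eq_zero, ← sub_sub]
  exact (QuotientAddGroup.eq_zero_iff _).2
    (AddSubgroup.subset_closure (CoendRel.add_right X ξ δ₁ δ₂))

theorem tmul_push {X Y : C} (a : X ⟶ Y) (ξ : F.obj (op Y)) (δ : Ext E Z X) :
    tmul E F ξ (push E a δ) = tmul E F ((F.map a.op).hom ξ) δ := by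
  rw [eq_comm, ← sub_eq_zero]
  exact (QuotientAddGroup.eq_zero_iff _).2
    (AddSubgroup.subset_closure (CoendRel.balance X Y a ξ δ))

@[simp]
theorem tmul_zero {X : C} (ξ : F.obj (op X)) : tmul E F ξ (0 : Ext E Z X) = 0 := by
  have := tmul_add (Z := Z) (E := E) ξ 0 0
  simpa using this

@[simp]
theorem zero_tmul {X : C} (δ : Ext E Z X) : tmul E F (0 : F.obj (op X)) δ = 0 := by
  have := add_tmul (F := F) 0 0 δ
  simpa using this

theorem neg_tmul {X : C} (ξ : F.obj (op X)) (δ : Ext E Z X) :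
    tmul E F (-ξ) δ = - tmul E F ξ δ := by
  rw [eq_neg_iff_add_eq_zero, ← add_tmul]; simp

@[simp]
theorem map_tmul {Z₁ X : C} (c : Z₁ ⟶ Z) (ξ : F.obj (op X)) (δ : Ext E Z X) :
    Coend.map E F c (tmul E F ξ δ) = tmul E F ξ (pull E c δ) := rfl

@[elab_as_elim]
theorem induction {p : Coend E F Z → Prop} (t : Coend E F Z)
    (tmul : ∀ (X : C) (ξ : F.obj (op X)) (δ : Ext E Z X), p (tmul E F ξ δ))
    (zero : p 0) (add : ∀ s t, p s → p t → p (s + t)) : p t := by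
  obtain ⟨w, rfl⟩ := QuotientAddGroup.mk_surjective t
  induction w using FreeAbelianGroup.induction_on with
  | zero => exact zero
  | of s => exact tmul _ _ _
  | neg s =>
    have := tmul s.1 (-s.2.1) s.2.2
    rwa [neg_tmul] at this
  | add s t hs ht => exact add _ _ hs ht

theorem hom_ext {G : Type*} [AddCommGroup G] {f g : Coend E F Z →+ G}
    (h : ∀ (X : C) (ξ : F.obj (op X)) (δ : Ext E Z X), f (tmul E F ξ δ) = g (tmul E F ξ δ)) :
    f = g := by
  refine AddMonoidHom.ext fun t => ?_
  induction t using Coend.induction with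
  | tmul X ξ δ => exact h X ξ δ
  | zero => simp
  | add s t hs ht => simp [hs, ht]

/-- The universal property of the coend. -/
noncomputable def lift {G : Type*} [AddCommGroup G] (f : ∀ X : C, F.obj (op X) → Ext E Z X → G)
    (hl : ∀ X ξ₁ ξ₂ δ, f X (ξ₁ + ξ₂) δ = f X ξ₁ δ + f X ξ₂ δ)
    (hr : ∀ X ξ δ₁ δ₂, f X ξ (δ₁ + δ₂) = f X ξ δ₁ + f X ξ δ₂)
    (hb : ∀ X Y (a : X ⟶ Y) ξ δ, f Y ξ (push E a δ) = f X ((F.map a.op).hom ξ) δ) :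
    Coend E F Z →+ G :=
  QuotientAddGroup.lift _ (FreeAbelianGroup.lift fun s => f s.1 s.2.1 s.2.2) (by
    rw [AddSubgroup.closure_le]
    rintro r hr'
    cases hr' with
    | add_left X ξ₁ ξ₂ δ => simp [hl]
    | add_right X ξ δ₁ δ₂ => simp [hr]
    | balance X Y a ξ δ => simp [hb])

@[simp]
theorem lift_tmul {G : Type*} [AddCommGroup G] (f : ∀ X : C, F.obj (op X) → Ext E Z X → G)
    (hl hr hb) {X : C} (ξ : F.obj (op X)) (δ : Ext E Z X) :
    lift f hl hr hb (tmul E F ξ δ) = f X ξ δ :=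
  FreeAbelianGroup.lift_apply_of _ _

end Coend

/-! ### Half exact functors and the vanishing of extensions -/

namespace Extriangulation

variable {C : Type u} [Category.{v} C] [Preadditive C] [HasZeroObject C] [HasBinaryBiproducts C]
variable (𝔼 : Extriangulation C)

/-- A contravariant functor to abelian groups is half exact if it is exact at the middle term of
every triangle. -/
def HalfExact (F : Cᵒᵖ ⥤ AddCommGrpCat.{max u v}) : Prop :=
  ∀ ⦃A B Z : C⦄ ⦃x : A ⟶ B⦄ ⦃y : B ⟶ Z⦄ ⦃δ : Ext 𝔼.E Z A⦄, 𝔼.IsTriangle x y δ →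
    ∀ β : F.obj (op B), (F.map x.op).hom β = 0 → ∃ γ : F.obj (op Z), (F.map y.op).hom γ = β

section Satellite

variable (F : Cᵒᵖ ⥤ AddCommGrpCat.{max u v})

theorem exists_eq_tmul {Z : C} (t : Coend 𝔼.E F Z) :
    ∃ (X : C) (ξ : F.obj (op X)) (δ : Ext 𝔼.E Z X), t = Coend.tmul 𝔼.E F ξ δ := by
  induction t using Coend.induction with
  | tmul X ξ δ => exact ⟨X, ξ, δ, rfl⟩
  | zero => exact ⟨Z, 0, 0, by simp⟩
  | add s t hs ht =>
    obtain ⟨X₁, ξ₁, δ₁, rfl⟩ := hs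
    obtain ⟨X₂, ξ₂, δ₂, rfl⟩ := ht
    refine ⟨X₁ ⊞ X₂, (F.map biprod.fst.op).hom ξ₁ + (F.map biprod.snd.op).hom ξ₂,
      push 𝔼.E biprod.inl δ₁ + push 𝔼.E biprod.inr δ₂, ?_⟩
    rw [Coend.add_tmul, ← Coend.tmul_push, ← Coend.tmul_push, map_add, map_add]
    simp [← push_comp]

theorem tensorExt_additive : (Extri.tensorExt 𝔼.E F).Additive where
  map_add {Z Z₁ c c'} := by
    refine congrArg AddCommGrpCat.ofHom (a₁ := Coend.map 𝔼.E F (c.unop + c'.unop))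
      (a₂ := Coend.map 𝔼.E F c.unop + Coend.map 𝔼.E F c'.unop) (Coend.hom_ext fun X ξ δ => ?_)
    simp [pull_add_hom, Coend.tmul_add]

/-- The extensions of `Z` by an arbitrary object, ordered by `(X, δ) ≤ (X₁, δ₁)` if `δ` is a
pushforward of `δ₁`. -/
def ExtensionsOf (Z : C) : Type (max u v) := Σ X : C, Ext 𝔼.E Z X

instance (Z : C) : Preorder (𝔼.ExtensionsOf Z) where
  le i j := ∃ a : j.1 ⟶ i.1, push 𝔼.E a j.2 = i.2
  le_refl i := ⟨𝟙 _, by simp⟩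
  le_trans i j k := by
    rintro ⟨a, ha⟩ ⟨b, hb⟩
    exact ⟨b ≫ a, by rw [push_comp, hb, ha]⟩

instance (Z : C) : IsDirectedOrder (𝔼.ExtensionsOf Z) where
  directed i j := ⟨⟨i.1 ⊞ j.1, push 𝔼.E biprod.inl i.2 + push 𝔼.E biprod.inr j.2⟩,
    ⟨biprod.fst, by simp [← push_comp]⟩, ⟨biprod.snd, by simp [← push_comp]⟩⟩

variable {𝔼} {Z : C}

/-- The middle term of a realization of an extension. -/
noncomputable def ExtensionsOf.mid (i : 𝔼.ExtensionsOf Z) : C := (𝔼.exists_triangle i.2).choose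

/-- The inflation of a realization of an extension. -/
noncomputable def ExtensionsOf.infl (i : 𝔼.ExtensionsOf Z) : i.1 ⟶ i.mid :=
  (𝔼.exists_triangle i.2).choose_spec.choose

theorem ExtensionsOf.isTriangle (i : 𝔼.ExtensionsOf Z) :
    ∃ y : i.mid ⟶ Z, 𝔼.IsTriangle i.infl y i.2 :=
  (𝔼.exists_triangle i.2).choose_spec.choose_spec

/-- For `i = (X, δ)` with realization `X ⟶ Y ⟶ Z`, the cokernel of `F(Y) ⟶ F(X)`. -/
abbrev ExtensionsOf.Coker (i : 𝔼.ExtensionsOf Z) : Type (max u v) :=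
  F.obj (op i.1) ⧸ (F.map i.infl.op).hom.range

/-- The transition map of the directed system of the groups `ExtensionsOf.Coker`. -/
noncomputable def ExtensionsOf.trans (i j : 𝔼.ExtensionsOf Z) (h : i ≤ j) :
    i.Coker F →+ j.Coker F :=
  QuotientAddGroup.map _ _ (F.map h.choose.op).hom (by
    rintro _ ⟨η, rfl⟩
    obtain ⟨y, hi⟩ := i.isTriangle
    obtain ⟨y', hj⟩ := j.isTriangle
    obtain ⟨b, hb, -⟩ := 𝔼.realize_hom h.choose (𝟙 Z) hj hi (by simpa using h.choose_spec)
    refine ⟨(F.map b.op).hom η, ?_⟩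
    simp only [← AddCommGrpCat.comp_apply, ← Functor.map_comp, ← op_comp, hb])

variable [F.Additive]

theorem ExtensionsOf.trans_mk (i j : 𝔼.ExtensionsOf Z) (h : i ≤ j) (a : j.1 ⟶ i.1)
    (ha : push 𝔼.E a j.2 = i.2) (ξ : F.obj (op i.1)) :
    ExtensionsOf.trans F i j h (QuotientAddGroup.mk ξ) =
      QuotientAddGroup.mk ((F.map a.op).hom ξ) := by
  refine (QuotientAddGroup.eq_iff_sub_mem.2 ?_)
  obtain ⟨y', hj⟩ := j.isTriangle
  -- two choices of `a` differ by a morphism that factors through the inflation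
  obtain ⟨b, hb⟩ := hj.exists_extension (h.choose - a) (by
    rw [sub_eq_add_neg, push_add_hom, push_neg_hom, ha, h.choose_spec, add_neg_cancel])
  refine ⟨(F.map b.op).hom ξ, ?_⟩
  rw [← AddCommGrpCat.comp_apply, ← Functor.map_comp, ← op_comp, hb, op_sub, Functor.map_sub]
  rfl

instance : DirectedSystem (fun i : 𝔼.ExtensionsOf Z => i.Coker F)
    fun i j h => ⇑(ExtensionsOf.trans F i j h) where
  map_self i t := by
    obtain ⟨ξ, rfl⟩ := QuotientAddGroup.mk_surjective t
    rw [ExtensionsOf.trans_mk F i i _ (𝟙 _) (by simp)]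
    simp
  map_map k j i hij hjk t := by
    obtain ⟨ξ, rfl⟩ := QuotientAddGroup.mk_surjective t
    obtain ⟨a, ha⟩ := hij
    obtain ⟨b, hb⟩ := hjk
    rw [ExtensionsOf.trans_mk F i j _ a ha, ExtensionsOf.trans_mk F j k _ b hb,
      ExtensionsOf.trans_mk F i k _ (b ≫ a) (by rw [push_comp, hb, ha])]
    simp

open Classical in
theorem ExtensionsOf.of_mk_eq (i j : 𝔼.ExtensionsOf Z) (a : j.1 ⟶ i.1)
    (ha : push 𝔼.E a j.2 = i.2) (ξ : F.obj (op i.1)) :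
    AddCommGroup.DirectLimit.of (fun i : 𝔼.ExtensionsOf Z => i.Coker F) (ExtensionsOf.trans F) i
        (QuotientAddGroup.mk ξ) =
      AddCommGroup.DirectLimit.of (fun i : 𝔼.ExtensionsOf Z => i.Coker F) (ExtensionsOf.trans F) j
        (QuotientAddGroup.mk ((F.map a.op).hom ξ)) := by
  have hij : i ≤ j := ⟨a, ha⟩
  rw [← ExtensionsOf.trans_mk F i j hij a ha, AddCommGroup.DirectLimit.of_f]

open Classical in
/-- The comparison of the coend with the directed colimit of the cokernels of `F(Y) ⟶ F(X)` over
all extensions `X ⟶ Y ⟶ Z`. -/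
noncomputable def toDirectLimit (Z : C) : Coend 𝔼.E F Z →+
    AddCommGroup.DirectLimit (fun i : 𝔼.ExtensionsOf Z => i.Coker F)
      (ExtensionsOf.trans F) :=
  Coend.lift
    (fun X ξ δ => AddCommGroup.DirectLimit.of (fun i : 𝔼.ExtensionsOf Z => i.Coker F)
      (ExtensionsOf.trans F) ⟨X, δ⟩ (QuotientAddGroup.mk ξ))
    (fun X ξ₁ ξ₂ δ => by rw [QuotientAddGroup.mk_add, map_add])
    (fun X ξ δ₁ δ₂ => by
      -- all three classes are compared at `(X ⊞ X, (δ₁, δ₂))`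
      let j : 𝔼.ExtensionsOf Z :=
        ⟨X ⊞ X, push 𝔼.E biprod.inl δ₁ + push 𝔼.E biprod.inr δ₂⟩
      have h₁ : push 𝔼.E biprod.fst j.2 = δ₁ := by simp [j, ← push_comp]
      have h₂ : push 𝔼.E biprod.snd j.2 = δ₂ := by simp [j, ← push_comp]
      have h₃ : push 𝔼.E (biprod.fst + biprod.snd) j.2 = δ₁ + δ₂ := by
        rw [push_add_hom, h₁, h₂]
      rw [ExtensionsOf.of_mk_eq F ⟨X, δ₁ + δ₂⟩ j _ h₃, ExtensionsOf.of_mk_eq F ⟨X, δ₁⟩ j _ h₁,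
        ExtensionsOf.of_mk_eq F ⟨X, δ₂⟩ j _ h₂, ← map_add, ← QuotientAddGroup.mk_add,
        op_add, Functor.map_add]
      rfl)
    (fun X Y a ξ δ => ExtensionsOf.of_mk_eq F ⟨Y, push 𝔼.E a δ⟩ ⟨X, δ⟩ a rfl ξ)

variable {F}

/-- Exactness of `F(Y) ⟶ F(X) ⟶ (F ⊗ E)(Z)` for a triangle `X ⟶ Y ⟶ Z` and a half exact
functor `F`. -/
theorem HalfExact.exists_of_tmul_eq_zero (hF : 𝔼.HalfExact F) {X Y : C} {x : X ⟶ Y} {y : Y ⟶ Z}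
    {δ : Ext 𝔼.E Z X} (h : 𝔼.IsTriangle x y δ) (ξ : F.obj (op X))
    (hξ : Coend.tmul 𝔼.E F ξ δ = 0) : ∃ η : F.obj (op Y), (F.map x.op).hom η = ξ := by
  classical
  have h0 := congrArg (toDirectLimit F Z) hξ
  rw [map_zero, toDirectLimit, Coend.lift_tmul] at h0
  obtain ⟨j, ⟨a, ha⟩, hj0⟩ := AddCommGroup.DirectLimit.of.zero_exact _ _ h0
  rw [ExtensionsOf.trans_mk F _ _ _ a ha, QuotientAddGroup.eq_zero_iff] at hj0
  obtain ⟨η', hη'⟩ := hj0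
  obtain ⟨y', hj⟩ := j.isTriangle
  -- `ξ` and `η'` agree on `j.1`, so they glue on the cone of `j.1 ⟶ X ⊞ j.mid`
  obtain ⟨Q, q, e, hq, he⟩ := hj.exists_cone a
  have hz : (F.map (biprod.lift a j.infl).op).hom
      ((F.map biprod.fst.op).hom ξ - (F.map biprod.snd.op).hom η') = 0 := by
    rw [map_sub, ← AddCommGrpCat.comp_apply, ← AddCommGrpCat.comp_apply, ← Functor.map_comp,
      ← Functor.map_comp, ← op_comp, ← op_comp, biprod.lift_fst, biprod.lift_snd, hη', sub_self]
  obtain ⟨γ, hγ⟩ := hF hq _ hz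
  obtain ⟨b, hb, -⟩ := 𝔼.equiv_of_triangle h (ha ▸ he)
  refine ⟨- (F.map b.hom.op).hom γ, ?_⟩
  have h3 := congrArg (F.map biprod.inl.op).hom hγ
  rw [map_sub] at h3
  simp only [← AddCommGrpCat.comp_apply, ← Functor.map_comp, ← op_comp, biprod.inl_fst,
    biprod.inl_snd, op_zero, Functor.map_zero] at h3
  rw [map_neg]
  simp only [← AddCommGrpCat.comp_apply, ← Functor.map_comp, ← op_comp, hb]
  rw [op_neg, Functor.map_neg]
  simpa using h3

theorem HalfExact.tensorExt (hF : 𝔼.HalfExact F) : 𝔼.HalfExact (tensorExt 𝔼.E F) := by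
  intro A B Z x y δ h β hβ
  obtain ⟨X, ξ, ε, rfl⟩ := 𝔼.exists_eq_tmul F β
  obtain ⟨Y, m, n, hY⟩ := 𝔼.exists_triangle ε
  obtain ⟨Q, h₁, d, e, δ₂, -, -, -, hQ, -, h6⟩ := 𝔼.et4_op hY h
  obtain ⟨ω, rfl⟩ := hF.exists_of_tmul_eq_zero hQ ξ hβ
  refine ⟨Coend.tmul 𝔼.E F ω δ₂, ?_⟩
  change Coend.tmul 𝔼.E F ω (pull 𝔼.E y δ₂) = _
  rw [← h6, Coend.tmul_push]

end Satellite

theorem higherExt_halfExact (A : C) (n : ℕ) : (higherExt 𝔼.E A (n + 1)).Additive ∧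
    𝔼.HalfExact (higherExt 𝔼.E A (n + 1)) := by
  induction n with
  | zero =>
    have := 𝔼.additive_left
    constructor
    · refine ⟨fun {Z Z₁ c c'} => ?_⟩
      ext t
      exact ULift.ext _ _ (𝔼.pull_add_hom c.unop c'.unop t.down)
    · intro X B Z x y δ h β hβ
      obtain ⟨γ, hγ⟩ := h.exists_pull_eq_of_pull_eq_zero β.down (congrArg ULift.down hβ)
      exact ⟨⟨γ⟩, ULift.ext _ _ hγ⟩
  | succ n ih =>
    have := ih.1
    exact ⟨tensorExt_additive _ _, ih.2.tensorExt⟩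

/-- For `K ∈ Mᵗ`, the higher extensions `Eⁱ(K, M)` vanish as long as `i + t ≤ d`. -/
theorem IsRigid.higherExt_subsingleton {𝔼 : Extriangulation C} {M : ObjectProperty C} {d : ℕ}
    (hM : IsAdditiveSubcategory M) (hrig : 𝔼.IsRigid M d) {t : ℕ} {K : C}
    (F : 𝔼.LeftFiltration M t K) {i : ℕ} (hi : i + 1 + t ≤ d) {X : C} (hX : M X) :
    Subsingleton ((higherExt 𝔼.E X (i + 1)).obj (op K)) := by
  induction F generalizing i with
  | zero hX₀ e => exact hrig _ (by omega) (by omega) _ _ (hM.of_iso e.symm hX₀) hX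
  | succ hX₀ x y δ tri G ih =>
    have := ih (i := i + 1) (by omega)
    have := hrig (i + 1) (by omega) (by omega) _ _ hX₀ hX
    obtain ⟨h1, h2⟩ := 𝔼.higherExt_halfExact X i
    refine subsingleton_of_forall_eq 0 fun ξ => ?_
    obtain ⟨η, rfl⟩ := h2.exists_of_tmul_eq_zero tri ξ (Subsingleton.elim (α :=
      (higherExt 𝔼.E X (i + 1 + 1)).obj (op _)) _ _)
    rw [Subsingleton.elim η 0, map_zero]

/-- The vanishing of `E(Mᵗ, M)` for `t < d`. -/
def LeftVanishing (M : ObjectProperty C) (d : ℕ) : Prop :=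
  ∀ ⦃t : ℕ⦄, t < d → ∀ ⦃K : C⦄, 𝔼.upper M t K → ∀ ⦃X : C⦄, M X → ∀ ε : Ext 𝔼.E K X, ε = 0

theorem IsRigid.leftVanishing {𝔼 : Extriangulation C} {M : ObjectProperty C} {d : ℕ}
    (hM : IsAdditiveSubcategory M) (hrig : 𝔼.IsRigid M d) : 𝔼.LeftVanishing M d := by
  rintro t ht K ⟨F⟩ X hX ε
  have := hrig.higherExt_subsingleton hM F (i := 0) (by omega) hX
  exact congrArg ULift.down (Subsingleton.elim (α := (higherExt 𝔼.E X 1).obj (op K)) ⟨ε⟩ ⟨0⟩)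

end Extriangulation

/-! ### Objects with a filtration and a given alternating sum -/

namespace SplitK0

variable {C : Type u} [Category.{v} C] [Preadditive C] [HasBinaryBiproducts C]
variable {M : ObjectProperty C}

theorem mk_congr {X Y : C} (hX : M X) (hY : M Y) (e : X ≅ Y) : mk M X hX = mk M Y hY :=
  congrArg (fun q => QuotientAddGroup.mk (FreeAbelianGroup.of q))
    (Quotient.sound (s := isIsomorphicSetoid M.FullSubcategory) ⟨M.isoMk e⟩)

theorem mk_biprod {X Y S : C} (hX : M X) (hY : M Y) (hS : M S) (e : S ≅ X ⊞ Y) :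
    mk M S hS = mk M X hX + mk M Y hY := by
  rw [← sub_eq_zero, ← sub_sub]
  exact (QuotientAddGroup.eq_zero_iff _).2
    (AddSubgroup.subset_closure ⟨⟨X, hX⟩, ⟨Y, hY⟩, ⟨S, hS⟩, ⟨e⟩, rfl⟩)

theorem mk_isZero [HasZeroObject C] {X : C} (hX : M X) (h : IsZero X) : mk M X hX = 0 := by
  have := mk_biprod hX hX hX
    ⟨0, 0, h.eq_of_src _ _, biprod.hom_ext _ _ (h.eq_of_tgt _ _) (h.eq_of_tgt _ _)⟩
  simpa using this

end SplitK0

namespace Extriangulation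

variable {C : Type u} [Category.{v} C] [Preadditive C] [HasZeroObject C] [HasBinaryBiproducts C]
variable (𝔼 : Extriangulation C) (M : ObjectProperty C)

/-- `X` has a left filtration of length `t` whose alternating sum is `k`. -/
def HasLeftIndex (t : ℕ) (X : C) (k : SplitK0 M) : Prop :=
  ∃ F : 𝔼.LeftFiltration M t X, F.altSum = k

/-- `X` has a right filtration of length `t` whose alternating sum is `k`. -/
def HasRightIndex (t : ℕ) (X : C) (k : SplitK0 M) : Prop :=
  ∃ F : 𝔼.RightFiltration M t X, F.altSum = k

variable {𝔼 M}

theorem LeftFiltration.hasLeftIndex {t : ℕ} {X : C} (F : 𝔼.LeftFiltration M t X) :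
    𝔼.HasLeftIndex M t X F.altSum := ⟨F, rfl⟩

theorem RightFiltration.hasRightIndex {t : ℕ} {X : C} (F : 𝔼.RightFiltration M t X) :
    𝔼.HasRightIndex M t X F.altSum := ⟨F, rfl⟩

theorem upper.hasLeftIndex {t : ℕ} {X : C} (h : 𝔼.upper M t X) :
    𝔼.HasLeftIndex M t X (leftIndex h) := ⟨_, rfl⟩

theorem lower.hasRightIndex {t : ℕ} {X : C} (h : 𝔼.lower M t X) :
    𝔼.HasRightIndex M t X (rightIndex h) := ⟨_, rfl⟩

theorem HasLeftIndex.upper {t : ℕ} {X : C} {k : SplitK0 M} (h : 𝔼.HasLeftIndex M t X k) :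
    𝔼.upper M t X := ⟨h.choose⟩

theorem HasRightIndex.lower {t : ℕ} {X : C} {k : SplitK0 M} (h : 𝔼.HasRightIndex M t X k) :
    𝔼.lower M t X := ⟨h.choose⟩

theorem HasLeftIndex.zero {X X₀ : C} (hX₀ : M X₀) (e : X ≅ X₀) :
    𝔼.HasLeftIndex M 0 X (SplitK0.mk M X₀ hX₀) := ⟨.zero hX₀ e, rfl⟩

theorem HasLeftIndex.succ {t : ℕ} {X X₀ K : C} {x : X ⟶ X₀} {y : X₀ ⟶ K} {δ : Ext 𝔼.E K X}
    {k : SplitK0 M} (hX₀ : M X₀) (tri : 𝔼.IsTriangle x y δ) (h : 𝔼.HasLeftIndex M t K k) :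
    𝔼.HasLeftIndex M (t + 1) X (SplitK0.mk M X₀ hX₀ - k) := by
  obtain ⟨G, rfl⟩ := h
  exact ⟨.succ hX₀ x y δ tri G, rfl⟩

theorem HasRightIndex.zero {X Y₀ : C} (hY₀ : M Y₀) (e : Y₀ ≅ X) :
    𝔼.HasRightIndex M 0 X (SplitK0.mk M Y₀ hY₀) := ⟨.zero hY₀ e, rfl⟩

theorem HasRightIndex.succ {t : ℕ} {X Y₀ P : C} {x : P ⟶ Y₀} {y : Y₀ ⟶ X} {δ : Ext 𝔼.E X P}
    {k : SplitK0 M} (hY₀ : M Y₀) (tri : 𝔼.IsTriangle x y δ) (h : 𝔼.HasRightIndex M t P k) :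
    𝔼.HasRightIndex M (t + 1) X (SplitK0.mk M Y₀ hY₀ - k) := by
  obtain ⟨G, rfl⟩ := h
  exact ⟨.succ hY₀ x y δ tri G, rfl⟩

theorem HasLeftIndex.exists_zero (hM : IsAdditiveSubcategory M) {X : C} {k : SplitK0 M}
    (h : 𝔼.HasLeftIndex M 0 X k) : ∃ hX : M X, k = SplitK0.mk M X hX := by
  obtain ⟨F, rfl⟩ := h
  obtain ⟨hX₀, e⟩ := F
  exact ⟨hM.of_iso e.symm hX₀, SplitK0.mk_congr _ _ e.symm⟩

theorem HasLeftIndex.exists_succ {t : ℕ} {X : C} {k : SplitK0 M}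
    (h : 𝔼.HasLeftIndex M (t + 1) X k) :
    ∃ (X₀ K : C) (hX₀ : M X₀) (x : X ⟶ X₀) (y : X₀ ⟶ K) (δ : Ext 𝔼.E K X) (k' : SplitK0 M),
      𝔼.IsTriangle x y δ ∧ 𝔼.HasLeftIndex M t K k' ∧ k = SplitK0.mk M X₀ hX₀ - k' := by
  obtain ⟨F, rfl⟩ := h
  cases F with
  | succ hX₀ x y δ tri G => exact ⟨_, _, hX₀, x, y, δ, _, tri, ⟨G, rfl⟩, rfl⟩

theorem HasRightIndex.exists_zero (hM : IsAdditiveSubcategory M) {X : C} {k : SplitK0 M}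
    (h : 𝔼.HasRightIndex M 0 X k) : ∃ hX : M X, k = SplitK0.mk M X hX := by
  obtain ⟨F, rfl⟩ := h
  obtain ⟨hY₀, e⟩ := F
  exact ⟨hM.of_iso e hY₀, SplitK0.mk_congr _ _ e⟩

theorem HasRightIndex.exists_succ {t : ℕ} {X : C} {k : SplitK0 M}
    (h : 𝔼.HasRightIndex M (t + 1) X k) :
    ∃ (Y₀ P : C) (hY₀ : M Y₀) (x : P ⟶ Y₀) (y : Y₀ ⟶ X) (δ : Ext 𝔼.E X P) (k' : SplitK0 M),
      𝔼.IsTriangle x y δ ∧ 𝔼.HasRightIndex M t P k' ∧ k = SplitK0.mk M Y₀ hY₀ - k' := by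
  obtain ⟨F, rfl⟩ := h
  cases F with
  | succ hY₀ x y δ tri G => exact ⟨_, _, hY₀, x, y, δ, _, tri, ⟨G, rfl⟩, rfl⟩

variable (hM : IsAdditiveSubcategory M)
include hM

theorem HasLeftIndex.lengthen {t : ℕ} {X : C} {k : SplitK0 M} (h : 𝔼.HasLeftIndex M t X k) :
    𝔼.HasLeftIndex M (t + 1) X k := by
  induction t generalizing X k with
  | zero =>
    obtain ⟨hX, rfl⟩ := h.exists_zero hM
    have h0 := hM.of_isZero (isZero_zero C)
    have := HasLeftIndex.succ hX (𝔼.triangle_id_zero (A := X) (isZero_zero C))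
      (HasLeftIndex.zero h0 (Iso.refl _))
    rwa [SplitK0.mk_isZero h0 (isZero_zero C), sub_zero] at this
  | succ t ih =>
    obtain ⟨X₀, K, hX₀, x, y, δ, k', tri, h', rfl⟩ := h.exists_succ
    exact .succ hX₀ tri (ih h')

theorem HasLeftIndex.of_le {s t : ℕ} (hst : s ≤ t) {X : C} {k : SplitK0 M}
    (h : 𝔼.HasLeftIndex M s X k) : 𝔼.HasLeftIndex M t X k := by
  induction hst with
  | refl => exact h
  | step _ ih => exact ih.lengthen hM

theorem HasLeftIndex.of_iso {t : ℕ} {X X' : C} {k : SplitK0 M} (h : 𝔼.HasLeftIndex M t X k)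
    (e : X ≅ X') : 𝔼.HasLeftIndex M t X' k := by
  cases t with
  | zero =>
    obtain ⟨hX, rfl⟩ := h.exists_zero hM
    exact .zero hX e.symm
  | succ t =>
    obtain ⟨X₀, K, hX₀, x, y, δ, k', tri, h', rfl⟩ := h.exists_succ
    exact .succ hX₀ (tri.of_iso_left e) h'

theorem HasLeftIndex.biprod_left {t : ℕ} {X D : C} {k : SplitK0 M}
    (h : 𝔼.HasLeftIndex M t X k) (hD : M D) :
    𝔼.HasLeftIndex M t (D ⊞ X) (SplitK0.mk M D hD + k) := by
  cases t with
  | zero =>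
    obtain ⟨hX, rfl⟩ := h.exists_zero hM
    rw [← SplitK0.mk_biprod hD hX (hM.biprod hD hX) (Iso.refl _)]
    exact .zero _ (Iso.refl _)
  | succ t =>
    obtain ⟨X₀, K, hX₀, x, y, δ, k', tri, h', rfl⟩ := h.exists_succ
    have := HasLeftIndex.succ (hM.biprod hD hX₀) (tri.biprod_left D) h'
    rwa [SplitK0.mk_biprod hD hX₀ _ (Iso.refl _), add_sub_assoc] at this

/-! ### Independence and additivity of the index -/

/-- Schanuel's lemma: filtrations of the same length of one object have the same alternating
sum. -/
theorem HasLeftIndex.unique_of_length {d : ℕ} (hV : 𝔼.LeftVanishing M d) {t : ℕ} (ht : t ≤ d)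
    {X : C} {k₁ k₂ : SplitK0 M} (h₁ : 𝔼.HasLeftIndex M t X k₁) (h₂ : 𝔼.HasLeftIndex M t X k₂) :
    k₁ = k₂ := by
  induction t generalizing X k₁ k₂ with
  | zero =>
    obtain ⟨_, rfl⟩ := h₁.exists_zero hM
    obtain ⟨_, rfl⟩ := h₂.exists_zero hM
    rfl
  | succ t ih =>
    obtain ⟨A, K, hA, x, y, δ, l₁, tri₁, hK, rfl⟩ := h₁.exists_succ
    obtain ⟨B, L, hB, x', y', δ', l₂, tri₂, hL, rfl⟩ := h₂.exists_succ
    obtain ⟨P, _, _, _, _, u₁, u₂⟩ := tri₁.exists_pushout tri₂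
    obtain ⟨e₁⟩ := u₁.nonempty_iso_biprod (hV ht hL.upper hA _)
    obtain ⟨e₂⟩ := u₂.nonempty_iso_biprod (hV ht hK.upper hB _)
    have := ih (by omega) (hL.biprod_left hM hA) ((hK.biprod_left hM hB).of_iso hM (e₂.symm ≪≫ e₁))
    rw [sub_eq_sub_iff_add_eq_add, this]

/-- The left index depends neither on the filtration nor on its length. -/
theorem HasLeftIndex.unique {d : ℕ} (hV : 𝔼.LeftVanishing M d) {s t : ℕ} (hs : s ≤ d) (ht : t ≤ d)
    {X : C} {k₁ k₂ : SplitK0 M} (h₁ : 𝔼.HasLeftIndex M s X k₁) (h₂ : 𝔼.HasLeftIndex M t X k₂) :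
    k₁ = k₂ :=
  (h₁.of_le hM hs).unique_of_length hM hV le_rfl (h₂.of_le hM ht)

/-- Horseshoe lemma: an extension of an object of `Mᵗ` by an object of `Mᵗ⁺¹` lies in `Mᵗ⁺¹`, and
the indices add up. -/
theorem HasLeftIndex.extension {d : ℕ} (hV : 𝔼.LeftVanishing M d) {t : ℕ} (ht : t + 1 ≤ d)
    {A B Z : C} {f : A ⟶ B} {g : B ⟶ Z} {δ : Ext 𝔼.E Z A} (tri : 𝔼.IsTriangle f g δ)
    {k₁ k₂ : SplitK0 M} (h₁ : 𝔼.HasLeftIndex M (t + 1) A k₁) (h₂ : 𝔼.HasLeftIndex M t Z k₂) :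
    𝔼.HasLeftIndex M (t + 1) B (k₁ + k₂) := by
  induction t generalizing A B Z k₁ k₂ with
  | zero =>
    obtain ⟨A₀, K, hA₀, x, y, ε, l, triA, hK, rfl⟩ := h₁.exists_succ
    obtain ⟨hZ, rfl⟩ := h₂.exists_zero hM
    obtain ⟨P, _, _, _, _, u₁, u₂⟩ := triA.exists_pushout tri
    obtain ⟨e⟩ := u₁.nonempty_iso_biprod (hV ht h₂.upper hA₀ _)
    have hP : M P := hM.of_iso e.symm (hM.biprod hA₀ hZ)
    have := HasLeftIndex.succ hP u₂ hK
    rwa [SplitK0.mk_biprod hA₀ hZ hP e, add_sub_right_comm] at this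
  | succ t ih =>
    obtain ⟨A₀, K, hA₀, x, y, ε, l, triA, hK, rfl⟩ := h₁.exists_succ
    obtain ⟨Z₀, L, hZ₀, z, w, ζ, m, triZ, hL, rfl⟩ := h₂.exists_succ
    obtain ⟨P, _, _, _, _, u₁, u₂⟩ := triA.exists_pushout tri
    obtain ⟨e⟩ := u₁.nonempty_iso_biprod (hV ht h₂.upper hA₀ _)
    obtain ⟨Q, _, _, _, _, q₁, -, -, q₂, -, -⟩ :=
      𝔼.et4 (u₂.of_iso_middle e) (triZ.biprod_left A₀)
    have := HasLeftIndex.succ (hM.biprod hA₀ hZ₀) q₁ (ih (by omega) q₂ hK hL)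
    rw [SplitK0.mk_biprod hA₀ hZ₀ _ (Iso.refl _)] at this
    convert this using 1
    abel

end Extriangulation

namespace Extriangulation

variable {C : Type u} [Category.{v} C] [Preadditive C] [HasZeroObject C] [HasBinaryBiproducts C]
variable {𝔼 : Extriangulation C} {M : ObjectProperty C}

/-! ### The functor `E(S, -)` determines the difference of the indices -/

theorem HasRightIndex.exists_one (hM : IsAdditiveSubcategory M) {X : C} {k : SplitK0 M}
    (h : 𝔼.HasRightIndex M 1 X k) :
    ∃ (Y₁ Y₀ : C) (hY₁ : M Y₁) (hY₀ : M Y₀) (x : Y₁ ⟶ Y₀) (y : Y₀ ⟶ X) (δ : Ext 𝔼.E X Y₁),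
      𝔼.IsTriangle x y δ ∧ k = SplitK0.mk M Y₀ hY₀ - SplitK0.mk M Y₁ hY₁ := by
  obtain ⟨Y₀, P, hY₀, x, y, δ, l, tri, hl, rfl⟩ := h.exists_succ
  obtain ⟨hP, rfl⟩ := hl.exists_zero hM
  exact ⟨P, Y₀, hP, hY₀, x, y, δ, tri, rfl⟩

/-- A natural transformation `E(S, -) ⟶ E(S₁, -)` on `M` is induced by a morphism `S₁ ⟶ S` if `S`
lies in `M₁`. -/
theorem IsTriangle.exists_hom_of_natural {Y₁ Y₀ S S₁ : C} {x : Y₁ ⟶ Y₀} {y : Y₀ ⟶ S}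
    {δ : Ext 𝔼.E S Y₁} (h : 𝔼.IsTriangle x y δ) (hY₁ : M Y₁) (hY₀ : M Y₀)
    (hE : ∀ X, M X → ∀ ε : Ext 𝔼.E Y₀ X, ε = 0)
    (φ : ∀ X, M X → (Ext 𝔼.E S X →+ Ext 𝔼.E S₁ X))
    (hφ : ∀ X Y (hX : M X) (hY : M Y) (a : X ⟶ Y) ε,
      φ Y hY (push 𝔼.E a ε) = push 𝔼.E a (φ X hX ε)) :
    ∃ c : S₁ ⟶ S, ∀ X hX ε, φ X hX ε = pull 𝔼.E c ε := by
  obtain ⟨c, hc⟩ := h.exists_pull_eq (φ Y₁ hY₁ δ)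
    (by rw [← hφ _ _ hY₁ hY₀, h.push_eq_zero, map_zero])
  refine ⟨c, fun X hX ε => ?_⟩
  obtain ⟨a, rfl⟩ := h.exists_push_eq ε (hE X hX _)
  rw [hφ _ _ hY₁ hX, ← hc, pull_push]

/-- If `E(S, -)` and `E(S₁, -)` are isomorphic on `M`, where `S` and `S₁` lie in `Mᵈ ∩ M₁`, then
the differences of the left and right indices of `S` and `S₁` agree. -/
theorem HasLeftIndex.sub_eq_of_natural (hM : IsAdditiveSubcategory M) {d : ℕ} (hd : 1 ≤ d)
    (hV : 𝔼.LeftVanishing M d) {S S₁ : C} {k l k₁ l₁ : SplitK0 M}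
    (hk : 𝔼.HasLeftIndex M d S k) (hl : 𝔼.HasRightIndex M 1 S l)
    (hk₁ : 𝔼.HasLeftIndex M d S₁ k₁) (hl₁ : 𝔼.HasRightIndex M 1 S₁ l₁)
    (φ : ∀ X, M X → (Ext 𝔼.E S X →+ Ext 𝔼.E S₁ X))
    (hφ : ∀ X Y (hX : M X) (hY : M Y) (a : X ⟶ Y) ε,
      φ Y hY (push 𝔼.E a ε) = push 𝔼.E a (φ X hX ε))
    (hb : ∀ X hX, Function.Bijective (φ X hX)) : k - l = k₁ - l₁ := by
  have hE : ∀ Y, M Y → ∀ X, M X → ∀ ε : Ext 𝔼.E Y X, ε = 0 := fun Y hY X hX ε =>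
    hV hd (HasLeftIndex.zero (𝔼 := 𝔼) hY (Iso.refl _)).upper hX ε
  obtain ⟨d, rfl⟩ : ∃ n, d = n + 1 := ⟨d - 1, by omega⟩
  obtain ⟨Y₁, Y₀, hY₁, hY₀, x, y, δ, tri, rfl⟩ := hl.exists_one hM
  obtain ⟨V₁, V₀, hV₁, hV₀, x', y', δ', tri', rfl⟩ := hl₁.exists_one hM
  obtain ⟨c, hc⟩ := tri.exists_hom_of_natural hY₁ hY₀ (hE _ hY₀) φ hφ
  replace hb : ∀ X, M X → Function.Bijective (pull 𝔼.E c : Ext 𝔼.E S X →+ Ext 𝔼.E S₁ X) :=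
    fun X hX => by rw [← AddMonoidHom.ext (hc X hX)]; exact hb X hX
  obtain ⟨X₀, K, hX₀, z, w, ζ, m, triS₁, hK, rfl⟩ := hk₁.exists_succ
  -- `T` is the cone of `S₁ ⟶ S ⊞ X₀`; it satisfies `E(T, M) = 0`
  obtain ⟨T, q, e, tT, tT'⟩ := triS₁.exists_cone c
  have hT : 𝔼.HasLeftIndex M (d + 1) T (k + m) := hk.extension hM hV le_rfl tT' hK
  have hTE : ∀ X, M X → ∀ τ : Ext 𝔼.E T X, τ = 0 := by
    intro X hX τ
    have h1 : pull 𝔼.E q τ = pull 𝔼.E biprod.fst (pull 𝔼.E biprod.inl (pull 𝔼.E q τ)) := by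
      conv_lhs => rw [𝔼.eq_fst_add_snd (pull 𝔼.E q τ)]
      rw [hE _ hX₀ _ hX (pull 𝔼.E biprod.inr (pull 𝔼.E q τ)), map_zero, add_zero]
    have h2 := congrArg (pull 𝔼.E (biprod.lift c z)) h1
    rw [← pull_comp, ← pull_comp, tT.comp_eq_zero, biprod.lift_fst, pull_zero_hom] at h2
    have h3 := (hb X hX).1 (h2.symm.trans (map_zero _).symm)
    rw [h3, map_zero] at h1
    obtain ⟨a, rfl⟩ := tT.exists_push_eq τ h1
    rw [← pull_push, hV (Nat.lt_succ_self d) hK.upper hX (push 𝔼.E a ζ), map_zero]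
  -- `W` is the pullback of `Y₀ ⊞ X₀ ⟶ S ⊞ X₀` along `S₁ ⟶ S ⊞ X₀`
  obtain ⟨W, _, _, _, _, tW', -, -, tW, -, -⟩ := 𝔼.et4_op (tri.biprod_right X₀) tT
  rw [← pull_comp, biprod.lift_fst] at tW
  have hWE : ∀ X, M X → ∀ ω : Ext 𝔼.E W X, ω = 0 := by
    intro X hX ω
    obtain ⟨σ', rfl⟩ := tW.exists_pull_eq_of_pull_eq_zero ω (hE _ hY₁ _ hX _)
    obtain ⟨σ, rfl⟩ := (hb X hX).2 σ'
    obtain ⟨a, rfl⟩ := tri.exists_push_eq σ (hE _ hY₀ _ hX _)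
    rw [pull_push, pull_push, tW.pull_eq_zero, map_zero]
  obtain ⟨P, _, _, _, _, u₁, u₂⟩ := tW.exists_pullback tri'
  obtain ⟨e₁⟩ := u₁.nonempty_iso_biprod (hE _ hV₀ _ hY₁ _)
  obtain ⟨e₂⟩ := u₂.nonempty_iso_biprod (hWE _ hV₁ _)
  have hP : M P := hM.of_iso e₁.symm (hM.biprod hY₁ hV₀)
  -- `W` is a direct summand of `P`, so the extension of `T` by `W` splits
  have hTW : ∀ ε : Ext 𝔼.E T W, ε = 0 := fun ε => by
    have := hTE P hP (push 𝔼.E (biprod.inr ≫ e₂.inv) ε)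
    have := congrArg (push 𝔼.E (e₂.hom ≫ biprod.snd)) this
    rwa [← push_comp, map_zero, Category.assoc, e₂.inv_hom_id_assoc, biprod.inr_snd,
      push_id] at this
  obtain ⟨e₃⟩ := tW'.nonempty_iso_biprod (hTW _)
  have e₄ : P ⊞ T ≅ V₁ ⊞ (Y₀ ⊞ X₀) :=
    biprod.mapIso e₂ (Iso.refl T) ≪≫ biprod.associator V₁ W T ≪≫
      biprod.mapIso (Iso.refl V₁) e₃.symm
  have hYX := hM.biprod hY₀ hX₀
  have key := HasLeftIndex.unique hM hV le_rfl (Nat.zero_le _) (hT.biprod_left hM hP)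
    (HasLeftIndex.zero (hM.biprod hV₁ hYX) e₄)
  rw [SplitK0.mk_biprod hV₁ hYX _ (Iso.refl _), SplitK0.mk_biprod hY₀ hX₀ hYX (Iso.refl _),
    SplitK0.mk_biprod hY₁ hV₀ hP e₁] at key
  rw [sub_eq_sub_iff_add_eq_add, ← sub_eq_zero]
  rw [← sub_eq_zero] at key
  rw [← key]
  abel

/-! ### The index along a triangle -/

/-- For a triangle `A ⟶ B ⟶ Z` of objects of `Mᵈ` there is `S` in `Mᵈ ∩ M₁` with a morphism
`Z ⟶ S` that identifies `E(S, -)` with the image of `Hom(A, -) ⟶ E(Z, -)` on `M`, and the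
alternating sum of the indices is the difference of the indices of `S`. -/
theorem IsTriangle.exists_leftIndex (hM : IsAdditiveSubcategory M) {d : ℕ} (hd : 1 ≤ d)
    (hV : 𝔼.LeftVanishing M d) {A B Z : C} {f : A ⟶ B} {g : B ⟶ Z} {δ : Ext 𝔼.E Z A}
    (tri : 𝔼.IsTriangle f g δ) {a b z : SplitK0 M} (hA : 𝔼.HasLeftIndex M d A a)
    (hB : 𝔼.HasLeftIndex M d B b) (hZ : 𝔼.HasLeftIndex M d Z z) :
    ∃ (S : C) (k l : SplitK0 M) (c : Z ⟶ S), 𝔼.HasLeftIndex M d S k ∧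
      𝔼.HasRightIndex M 1 S l ∧ a - b + z = k - l ∧
      ∀ X, M X → Function.Injective (pull 𝔼.E c : Ext 𝔼.E S X →+ Ext 𝔼.E Z X) ∧
        ∀ ε : Ext 𝔼.E Z X, (∃ σ, pull 𝔼.E c σ = ε) ↔ ∃ h : A ⟶ X, push 𝔼.E h δ = ε := by
  have hE : ∀ Y, M Y → ∀ X, M X → ∀ ε : Ext 𝔼.E Y X, ε = 0 := fun Y hY X hX ε =>
    hV hd (HasLeftIndex.zero (𝔼 := 𝔼) hY (Iso.refl _)).upper hX ε
  obtain ⟨d, rfl⟩ : ∃ n, d = n + 1 := ⟨d - 1, by omega⟩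
  obtain ⟨A₀, A', hA₀, x, y, ε, a', triA, hA', rfl⟩ := hA.exists_succ
  -- `P` is the pushout of `A ⟶ B` and `A ⟶ A₀`
  obtain ⟨P, i, p, _, _, u₁, u₂⟩ := triA.exists_pushout tri
  obtain ⟨P₀, P', hP₀, s, t, π, p', triP, hP', hp'⟩ :=
    (hB.extension hM hV le_rfl u₂ hA').exists_succ
  obtain ⟨S, h₁, c, c', δ₂, tS, -, -, tS', r, -⟩ := 𝔼.et4 u₁ triP
  refine ⟨S, _, _, c, hZ.extension hM hV le_rfl tS' hP',
    .succ hP₀ tS (.zero hA₀ (Iso.refl _)), ?_, fun X hX => ⟨?_, fun η => ⟨?_, ?_⟩⟩⟩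
  · obtain rfl : p' = SplitK0.mk M P₀ hP₀ - (b + a') := by rw [hp']; abel
    abel
  · rw [injective_iff_map_eq_zero]
    intro σ hσ
    obtain ⟨τ, rfl⟩ := tS'.exists_pull_eq_of_pull_eq_zero σ hσ
    rw [hV (Nat.lt_succ_self d) hP'.upper hX τ, map_zero]
  · rintro ⟨σ, rfl⟩
    obtain ⟨j, rfl⟩ := tS.exists_push_eq σ (hE _ hP₀ _ hX _)
    exact ⟨x ≫ j, by rw [pull_push, r, push_comp]⟩
  · rintro ⟨h, rfl⟩
    obtain ⟨j, rfl⟩ := triA.exists_extension h (hV (Nat.lt_succ_self d) hA'.upper hX _)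
    exact ⟨push 𝔼.E j δ₂, by rw [pull_push, r, push_comp]⟩

end Extriangulation

/-! ### The opposite extriangulated category -/

section OpBiprod

variable {C : Type u} [Category.{v} C] [Preadditive C] [HasBinaryBiproducts C]

/-- Biproducts in the opposite category are biproducts of the underlying objects. -/
noncomputable def opBiprod (A B : Cᵒᵖ) : A ⊞ B ≅ op (A.unop ⊞ B.unop) where
  hom := biprod.desc (biprod.fst : A.unop ⊞ B.unop ⟶ _).op (biprod.snd : A.unop ⊞ B.unop ⟶ _).op
  inv := (biprod.lift (biprod.inl : A ⟶ A ⊞ B).unop (biprod.inr : B ⟶ A ⊞ B).unop).op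
  hom_inv_id := by ext <;> simp [← op_comp]
  inv_hom_id := by
    refine Quiver.Hom.unop_inj (biprod.hom_ext _ _ ?_ ?_)
    · rw [unop_comp, Category.assoc, Quiver.Hom.unop_op, biprod.lift_fst, ← unop_comp,
        biprod.inl_desc]
      simp
    · rw [unop_comp, Category.assoc, Quiver.Hom.unop_op, biprod.lift_snd, ← unop_comp,
        biprod.inr_desc]
      simp

@[simp]
theorem inl_opBiprod (A B : Cᵒᵖ) :
    biprod.inl ≫ (opBiprod A B).hom.unop = (biprod.fst : A ⊞ B ⟶ A).unop := by
  refine Quiver.Hom.op_inj (biprod.hom_ext' _ _ ?_ ?_) <;>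
  · rw [op_comp, Quiver.Hom.op_unop, ← Category.assoc]
    simp [opBiprod, ← op_comp]

@[simp]
theorem inr_opBiprod (A B : Cᵒᵖ) :
    biprod.inr ≫ (opBiprod A B).hom.unop = (biprod.snd : A ⊞ B ⟶ B).unop := by
  refine Quiver.Hom.op_inj (biprod.hom_ext' _ _ ?_ ?_) <;>
  · rw [op_comp, Quiver.Hom.op_unop, ← Category.assoc]
    simp [opBiprod, ← op_comp]

@[simp]
theorem opBiprod_inl (A B : Cᵒᵖ) :
    (opBiprod A B).hom.unop ≫ (biprod.inl : A ⟶ A ⊞ B).unop = biprod.fst :=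
  Quiver.Hom.op_inj (by simp [opBiprod])

@[simp]
theorem opBiprod_inr (A B : Cᵒᵖ) :
    (opBiprod A B).hom.unop ≫ (biprod.inr : B ⟶ A ⊞ B).unop = biprod.snd :=
  Quiver.Hom.op_inj (by simp [opBiprod])

theorem opBiprod_naturality {A B A₁ B₁ : Cᵒᵖ} (f : A ⟶ A₁) (g : B ⟶ B₁) :
    biprod.map f.unop g.unop ≫ (opBiprod A B).hom.unop =
      (opBiprod A₁ B₁).hom.unop ≫ (biprod.map f g).unop := by
  refine biprod.hom_ext' _ _ ?_ ?_
  · rw [← Category.assoc, biprod.inl_map, Category.assoc, inl_opBiprod, ← Category.assoc,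
      inl_opBiprod, ← unop_comp, ← unop_comp, biprod.map_fst]
  · rw [← Category.assoc, biprod.inr_map, Category.assoc, inr_opBiprod, ← Category.assoc,
      inr_opBiprod, ← unop_comp, ← unop_comp, biprod.map_snd]

variable {M : ObjectProperty C}

theorem IsAdditiveSubcategory.op (hM : IsAdditiveSubcategory M) :
    IsAdditiveSubcategory M.op where
  of_iso e h := hM.of_iso e.unop.symm h
  of_isZero h := hM.of_isZero h.unop
  biprod {X Y} hX hY := hM.of_iso (opBiprod X Y).unop (hM.biprod hX hY)

/-- The homomorphism `[X] ↦ [X]` from the split Grothendieck group of the opposite subcategory. -/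
noncomputable def SplitK0.unop :
    SplitK0 M.op →+ SplitK0 M :=
  QuotientAddGroup.lift _ (FreeAbelianGroup.lift (Quotient.lift
    (fun X : M.op.FullSubcategory => SplitK0.mk M X.obj.unop X.property)
    fun X Y ⟨e⟩ => SplitK0.mk_congr _ _ (M.op.ι.mapIso e).unop.symm)) (by
    rw [AddSubgroup.closure_le]
    rintro r ⟨X, Y, S, ⟨e⟩, rfl⟩
    change FreeAbelianGroup.lift _ _ = 0
    rw [map_sub, map_sub, isoClass, isoClass, isoClass, FreeAbelianGroup.lift_apply_of,
      FreeAbelianGroup.lift_apply_of, FreeAbelianGroup.lift_apply_of, sub_sub, sub_eq_zero]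
    exact SplitK0.mk_biprod _ _ _ (e.unop.symm ≪≫ (opBiprod X.obj Y.obj).unop.symm))

theorem SplitK0.unop_mk {X : C} (hX : M X) :
    SplitK0.unop (SplitK0.mk M.op (op X) hX) = SplitK0.mk M X hX :=
  FreeAbelianGroup.lift_apply_of _ _

end OpBiprod

section OpExt

variable {C : Type u} [Category.{v} C] (E : Cᵒᵖ ⥤ C ⥤ AddCommGrpCat.{v})

/-- The bifunctor `(A, Z) ↦ E(Z, A)` of the opposite category. -/
def opExt : Cᵒᵖᵒᵖ ⥤ Cᵒᵖ ⥤ AddCommGrpCat.{v} := unopUnop C ⋙ E.flip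

end OpExt

namespace Extriangulation

variable {C : Type u} [Category.{v} C] [Preadditive C] [HasZeroObject C] [HasBinaryBiproducts C]

/-- The opposite of an extriangulated category: `A ⟶ B ⟶ Z` is a triangle in `Cᵒᵖ` if
`Z ⟶ B ⟶ A` is a triangle in `C`. -/
def opposite (𝔼 : Extriangulation C) : Extriangulation Cᵒᵖ where
  E := opExt 𝔼.E
  additive_left := ⟨fun {Z Z₁ c c'} => by
    ext A δ
    exact 𝔼.push_add_hom c.unop.unop c'.unop.unop δ⟩
  additive_right Z := ⟨fun {A A₁ a a'} => by
    ext δ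
    exact 𝔼.pull_add_hom a.unop a'.unop δ⟩
  IsTriangle {A B Z} x y δ :=
    𝔼.IsTriangle (A := Z.unop) (B := B.unop) (Z := A.unop) y.unop x.unop δ
  exists_triangle δ := by
    obtain ⟨B, x, y, h⟩ := 𝔼.exists_triangle δ
    exact ⟨op B, y.op, x.op, h⟩
  equiv_of_triangle h h₁ := by
    obtain ⟨b, hx, hy⟩ := 𝔼.equiv_of_triangle h h₁
    exact ⟨b.symm.op, Quiver.Hom.unop_inj (by simp [← hy]), Quiver.Hom.unop_inj (by simp [← hx])⟩
  triangle_of_equiv b hx hy h :=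
    𝔼.triangle_of_equiv b.symm.unop (by simp [← hy, ← unop_comp]) (by simp [← hx, ← unop_comp]) h
  realize_hom a c h h₁ he := by
    obtain ⟨b, hx, hy⟩ := 𝔼.realize_hom c.unop a.unop h₁ h he.symm
    exact ⟨b.op, Quiver.Hom.unop_inj hy.symm, Quiver.Hom.unop_inj hx.symm⟩
  zero_triangle A Z :=
    𝔼.triangle_of_equiv (opBiprod A Z).unop (by simp) (by simp)
      (𝔼.zero_triangle_inr A.unop Z.unop)
  biprod_triangle {A B Z A₁ B₁ Z₁ x y δ x₁ y₁ δ₁} h h₁ := by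
    refine (𝔼.biprod_triangle h h₁).of_iso (opBiprod Z Z₁).unop (opBiprod B B₁).unop
      (opBiprod A A₁).unop ?_ ?_ ?_
    · exact opBiprod_naturality y y₁
    · exact opBiprod_naturality x x₁
    · refine Eq.trans ?_ (map_add (pull 𝔼.E (opBiprod A A₁).hom.unop)
        (pull 𝔼.E (biprod.inl : A ⟶ A ⊞ A₁).unop (push 𝔼.E (biprod.fst : Z ⊞ Z₁ ⟶ Z).unop δ))
        (pull 𝔼.E (biprod.inr : A₁ ⟶ A ⊞ A₁).unop
          (push 𝔼.E (biprod.snd : Z ⊞ Z₁ ⟶ Z₁).unop δ₁))).symm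
      simp only [map_add, Iso.unop_hom, ← push_comp, ← pull_comp, inl_opBiprod, inr_opBiprod,
        opBiprod_inl, opBiprod_inr]
      exact congrArg₂ (· + ·) (pull_push 𝔼.E _ _ δ).symm (pull_push 𝔼.E _ _ δ₁).symm
  et3 a b h h₁ he := by
    obtain ⟨c, hc, hc'⟩ := 𝔼.et3_op b.unop a.unop h₁ h (Quiver.Hom.op_inj he.symm)
    exact ⟨c.op, Quiver.Hom.unop_inj hc.symm, hc'.symm⟩
  et3_op b c h h₁ he := by
    obtain ⟨a, ha, ha'⟩ := 𝔼.et3 c.unop b.unop h₁ h (Quiver.Hom.op_inj he.symm)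
    exact ⟨a.op, Quiver.Hom.unop_inj ha.symm, ha'.symm⟩
  et4 h h' := by
    obtain ⟨Q, h₁, d, e, δ₂, t₁, e₁, e₂, t₂, e₃, e₄⟩ := 𝔼.et4_op h' h
    exact ⟨op Q, h₁.op, e.op, d.op, δ₂, t₁, Quiver.Hom.unop_inj e₂, Quiver.Hom.unop_inj e₁,
      t₂, e₃, e₄.symm⟩
  et4_op h h' := by
    obtain ⟨Q, h₁, d, e, δ₂, t₁, e₁, e₂, t₂, e₃, e₄⟩ := 𝔼.et4 h' h
    exact ⟨op Q, h₁.op, e.op, d.op, δ₂, t₁, Quiver.Hom.unop_inj e₂, Quiver.Hom.unop_inj e₁,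
      t₂, e₃, e₄.symm⟩

variable {𝔼 : Extriangulation C} {M : ObjectProperty C}

theorem IsTriangle.opposite {A B Z : C} {x : A ⟶ B} {y : B ⟶ Z} {δ : Ext 𝔼.E Z A}
    (h : 𝔼.IsTriangle x y δ) :
    𝔼.opposite.IsTriangle (A := op Z) (B := op B) (Z := op A) y.op x.op δ := h

theorem HasRightIndex.opposite (hM : IsAdditiveSubcategory M) {t : ℕ} {X : C} {k : SplitK0 M}
    (h : 𝔼.HasRightIndex M t X k) :
    ∃ k', 𝔼.opposite.HasLeftIndex M.op t (op X) k' ∧ SplitK0.unop k' = k := by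
  induction t generalizing X k with
  | zero =>
    obtain ⟨hX, rfl⟩ := h.exists_zero hM
    exact ⟨_, .zero (M := M.op) (X₀ := op X) hX (Iso.refl _), SplitK0.unop_mk hX⟩
  | succ t ih =>
    obtain ⟨Y₀, P, hY₀, x, y, δ, l, tri, hl, rfl⟩ := h.exists_succ
    obtain ⟨l', h', rfl⟩ := ih hl
    exact ⟨_, .succ (M := M.op) (X₀ := op Y₀) hY₀ tri.opposite h',
      by rw [map_sub, SplitK0.unop_mk]⟩

theorem HasLeftIndex.opposite (hM : IsAdditiveSubcategory M) {t : ℕ} {X : C} {k : SplitK0 M}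
    (h : 𝔼.HasLeftIndex M t X k) :
    ∃ k', 𝔼.opposite.HasRightIndex M.op t (op X) k' ∧ SplitK0.unop k' = k := by
  induction t generalizing X k with
  | zero =>
    obtain ⟨hX, rfl⟩ := h.exists_zero hM
    exact ⟨_, .zero (M := M.op) (Y₀ := op X) hX (Iso.refl _), SplitK0.unop_mk hX⟩
  | succ t ih =>
    obtain ⟨X₀, K, hX₀, x, y, δ, l, tri, hl, rfl⟩ := h.exists_succ
    obtain ⟨l', h', rfl⟩ := ih hl
    exact ⟨_, .succ (M := M.op) (Y₀ := op X₀) hX₀ tri.opposite h',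
      by rw [map_sub, SplitK0.unop_mk]⟩

theorem HasLeftIndex.unop (hM : IsAdditiveSubcategory M) {t : ℕ} {X : Cᵒᵖ} {k : SplitK0 M.op}
    (h : 𝔼.opposite.HasLeftIndex M.op t X k) :
    𝔼.HasRightIndex M t X.unop (SplitK0.unop k) := by
  induction t generalizing X k with
  | zero =>
    obtain ⟨hX, rfl⟩ := h.exists_zero hM.op
    rw [SplitK0.unop_mk (X := X.unop) hX]
    exact .zero _ (Iso.refl _)
  | succ t ih =>
    obtain ⟨X₀, K, hX₀, x, y, δ, l, tri, hl, rfl⟩ := h.exists_succ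
    rw [map_sub, SplitK0.unop_mk (X := X₀.unop) hX₀]
    exact .succ (x := y.unop) (y := x.unop) (δ := δ) hX₀ tri (ih hl)

theorem HasRightIndex.unop (hM : IsAdditiveSubcategory M) {t : ℕ} {X : Cᵒᵖ} {k : SplitK0 M.op}
    (h : 𝔼.opposite.HasRightIndex M.op t X k) :
    𝔼.HasLeftIndex M t X.unop (SplitK0.unop k) := by
  induction t generalizing X k with
  | zero =>
    obtain ⟨hX, rfl⟩ := h.exists_zero hM.op
    rw [SplitK0.unop_mk (X := X.unop) hX]
    exact .zero _ (Iso.refl _)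
  | succ t ih =>
    obtain ⟨Y₀, P, hY₀, x, y, δ, l, tri, hl, rfl⟩ := h.exists_succ
    rw [map_sub, SplitK0.unop_mk (X := Y₀.unop) hY₀]
    exact .succ (x := y.unop) (y := x.unop) (δ := δ) hY₀ tri (ih hl)

end Extriangulation

/-! ### Higher extensions in the opposite category -/

section

variable {C : Type u} [Category.{v} C] (E : Cᵒᵖ ⥤ C ⥤ AddCommGrpCat.{v})

/-- Functoriality of `F ⊗ E` in `F`. -/
noncomputable def tensorExtMap {F F₁ : Cᵒᵖ ⥤ AddCommGrpCat.{max u v}} (η : F ⟶ F₁) :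
    tensorExt E F ⟶ tensorExt E F₁ where
  app Z := AddCommGrpCat.ofHom (Coend.lift
    (fun X ξ δ => Coend.tmul E F₁ ((η.app (op X)).hom ξ) δ)
    (fun X ξ₁ ξ₂ δ => by rw [map_add, Coend.add_tmul])
    (fun X ξ δ₁ δ₂ => Coend.tmul_add _ _ _)
    (fun X Y a ξ δ => by
      rw [Coend.tmul_push]
      exact congrArg (Coend.tmul E F₁ · δ) (ConcreteCategory.congr_hom (η.naturality a.op) ξ).symm))
  naturality Z Z₁ c := by
    refine AddCommGrpCat.hom_ext (Coend.hom_ext fun X ξ δ => rfl)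

variable [Preadditive C]

/-- The pushforward `Eⁿ⁺¹(-, A) ⟶ Eⁿ⁺¹(-, A₁)` along `a : A ⟶ A₁`. -/
noncomputable def higherPush {A A₁ : C} (a : A ⟶ A₁) :
    ∀ n : ℕ, higherExt E A (n + 1) ⟶ higherExt E A₁ (n + 1)
  | 0 => Functor.whiskerRight (E.flip.map a) AddCommGrpCat.uliftFunctor.{u, v}
  | n + 1 => tensorExtMap E (higherPush a n)

/-- Left multiplication `Eⁿ⁺¹(-, X) ⟶ Eⁿ⁺²(-, A)` by an extension in `E(X, A)`. -/
noncomputable def splice {X A : C} (δ : Ext E X A) :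
    ∀ n : ℕ, higherExt E X (n + 1) ⟶ higherExt E A (n + 2)
  | 0 =>
    { app := fun Z => AddCommGrpCat.ofHom (AddMonoidHom.mk' (G := Coend E (higherExt E A 1) Z.unop)
        (fun ε : ULift.{u} (Ext E Z.unop X) =>
          Coend.tmul E (higherExt E A 1) (X := X) (ULift.up δ) ε.down)
        (fun _ _ => Coend.tmul_add _ _ _))
      naturality := fun _ _ _ => rfl }
  | n + 1 => tensorExtMap E (splice δ n)

theorem splice_add {X A : C} (δ₁ δ₂ : Ext E X A) (n : ℕ) {Z : C}
    (ξ : (higherExt E X (n + 1)).obj (op Z)) :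
    ((splice E (δ₁ + δ₂) n).app (op Z)).hom ξ =
      ((splice E δ₁ n).app (op Z)).hom ξ + ((splice E δ₂ n).app (op Z)).hom ξ := by
  induction n generalizing Z with
  | zero => exact Coend.add_tmul (F := higherExt E A 1) (ULift.up δ₁) (ULift.up δ₂) ξ.down
  | succ n ih =>
    refine DFunLike.congr_fun (f := ((splice E (δ₁ + δ₂) (n + 1)).app (op Z)).hom)
      (g := ((splice E δ₁ (n + 1)).app (op Z)).hom + ((splice E δ₂ (n + 1)).app (op Z)).hom)
      (Coend.hom_ext fun W ξ ε => ?_) ξ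
    refine (congrArg (Coend.tmul E (higherExt E A (n + 2)) · ε) (ih ξ)).trans ?_
    exact Coend.add_tmul _ _ ε

theorem splice_pull {X X₁ A : C} (b : X ⟶ X₁) (δ : Ext E X₁ A) (n : ℕ) {Z : C}
    (ξ : (higherExt E X (n + 1)).obj (op Z)) :
    ((splice E (pull E b δ) n).app (op Z)).hom ξ =
      ((splice E δ n).app (op Z)).hom (((higherPush E b n).app (op Z)).hom ξ) := by
  induction n generalizing Z with
  | zero => exact (Coend.tmul_push (F := higherExt E A 1) b (ULift.up δ) ξ.down).symm
  | succ n ih =>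
    refine DFunLike.congr_fun (f := ((splice E (pull E b δ) (n + 1)).app (op Z)).hom)
      (g := ((splice E δ (n + 1)).app (op Z)).hom.comp
        ((higherPush E b (n + 1)).app (op Z)).hom)
      (Coend.hom_ext fun W ξ ε => ?_) ξ
    exact congrArg (Coend.tmul E (higherExt E A (n + 2)) · ε) (ih ξ)

theorem higherPush_splice {X A A₁ : C} (a : A ⟶ A₁) (δ : Ext E X A) (n : ℕ) {Z : C}
    (ξ : (higherExt E X (n + 1)).obj (op Z)) :
    ((higherPush E a (n + 1)).app (op Z)).hom (((splice E δ n).app (op Z)).hom ξ) =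
      ((splice E (push E a δ) n).app (op Z)).hom ξ := by
  induction n generalizing Z with
  | zero => rfl
  | succ n ih =>
    refine DFunLike.congr_fun (f := ((higherPush E a (n + 2)).app (op Z)).hom.comp
        ((splice E δ (n + 1)).app (op Z)).hom)
      (g := ((splice E (push E a δ) (n + 1)).app (op Z)).hom)
      (Coend.hom_ext fun W ξ ε => ?_) ξ
    exact congrArg (Coend.tmul E (higherExt E A₁ (n + 2)) · ε) (ih ξ)

/-- A comparison `Eⁿ⁺¹(Z, A) ⟶ Eⁿ⁺¹(A, Z)` of the higher extensions of a bifunctor with those of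
its opposite, compatible with morphisms in `Z`. -/
structure Reversal (A : C) (n : ℕ) where
  /-- the components of the comparison -/
  hom (Z : C) : (higherExt E A (n + 1)).obj (op Z) →+
    (higherExt (opExt E) (op Z) (n + 1)).obj (op (op A))
  /-- the compatibility with morphisms in `Z` -/
  naturality (X Y : C) (a : X ⟶ Y) (ξ : (higherExt E A (n + 1)).obj (op Y)) :
    hom X (((higherExt E A (n + 1)).map a.op).hom ξ) =
      ((higherPush (opExt E) a.op n).app (op (op A))).hom (hom Y ξ)

variable {E} in
/-- The inductive step in the construction of the reversal: `ξ ⊗ δ` is sent to the product of `δ`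
and the reversal of `ξ`. -/
noncomputable def Reversal.step {A : C} {n : ℕ} (ρ : Reversal E A n) (Z : C) :
    Coend E (higherExt E A (n + 1)) Z →+
      (higherExt (opExt E) (op Z) (n + 2)).obj (op (op A)) :=
  Coend.lift
    (fun X ξ δ =>
      ((splice (opExt E) (X := op X) (A := op Z) δ n).app (op (op A))).hom (ρ.hom X ξ))
    (fun X ξ₁ ξ₂ δ => by rw [map_add, map_add])
    (fun X ξ δ₁ δ₂ => splice_add (opExt E) (X := op X) (A := op Z) δ₁ δ₂ n _)
    (fun X Y a ξ δ => by
      rw [ρ.naturality]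
      exact splice_pull (opExt E) (A := op Z) a.op δ n _)

variable {E} in
theorem Reversal.step_tmul {A : C} {n : ℕ} (ρ : Reversal E A n) {Z X : C}
    (ξ : (higherExt E A (n + 1)).obj (op X)) (δ : Ext E Z X) :
    ρ.step Z (Coend.tmul E _ ξ δ) =
      ((splice (opExt E) (X := op X) (A := op Z) δ n).app (op (op A))).hom (ρ.hom X ξ) :=
  Coend.lift_tmul _ _ _ _ _ _

/-- The comparison that reads chains of composable extensions backwards. -/
noncomputable def reversal (A : C) : ∀ n : ℕ, Reversal E A n
  | 0 => ⟨fun Z => AddMonoidHom.id (ULift.{u} (Ext E Z A)), fun X Y a ξ => rfl⟩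
  | n + 1 => ⟨fun Z => (reversal A n).step Z, fun X Y a ξ => by
      refine DFunLike.congr_fun
        (f := ((reversal A n).step X).comp (Coend.map E (higherExt E A (n + 1)) a))
        (g := ((higherPush (opExt E) a.op (n + 1)).app (op (op A))).hom.comp
          ((reversal A n).step Y)) (Coend.hom_ext fun W ξ ε => ?_) ξ
      rw [AddMonoidHom.comp_apply, AddMonoidHom.comp_apply, Coend.map_tmul, Reversal.step_tmul,
        Reversal.step_tmul]
      exact (higherPush_splice (opExt E) (X := op W) a.op ε n _).symm⟩

/-- Reading a chain of composable extensions backwards. -/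
noncomputable def reverse (A Z : C) (n : ℕ) : (higherExt E A (n + 1)).obj (op Z) →+
    (higherExt (opExt E) (op Z) (n + 1)).obj (op (op A)) :=
  (reversal E A n).hom Z

theorem reverse_tmul (A Z : C) (n : ℕ) {X : C} (ξ : (higherExt E A (n + 1)).obj (op X))
    (δ : Ext E Z X) :
    reverse E A Z (n + 1) (Coend.tmul E (higherExt E A (n + 1)) ξ δ) =
      ((splice (opExt E) (X := op X) (A := op Z) δ n).app (op (op A))).hom
        (reverse E A X n ξ) :=
  Reversal.step_tmul _ _ _

theorem reverse_splice {X A : C} (δ : Ext E X A) (n : ℕ) {Z : C}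
    (ξ : (higherExt E X (n + 1)).obj (op Z)) :
    reverse E A Z (n + 1) (((splice E δ n).app (op Z)).hom ξ) =
      Coend.tmul (opExt E) (higherExt (opExt E) (op Z) (n + 1)) (X := op X) (Z := op A)
        (reverse E X Z n ξ) δ := by
  induction n generalizing Z with
  | zero => rfl
  | succ n ih =>
    let T : (higherExt (opExt E) (op Z) (n + 2)).obj (op (op X)) →+
        Coend (opExt E) (higherExt (opExt E) (op Z) (n + 2)) (op A) :=
      AddMonoidHom.mk' (fun t => Coend.tmul (opExt E) (higherExt (opExt E) (op Z) (n + 2))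
        (X := op X) (Z := op A) t δ) (fun s t => Coend.add_tmul s t _)
    refine DFunLike.congr_fun (f := (reverse E A Z (n + 2)).comp
      ((splice E δ (n + 1)).app (op Z)).hom) (g := T.comp (reverse E X Z (n + 1)))
      (Coend.hom_ext fun W ξ ε => ?_) ξ
    change reverse E A Z (n + 2) (Coend.tmul E (higherExt E A (n + 2))
      (((splice E δ n).app (op W)).hom ξ) ε) =
        T (reverse E X Z (n + 1) (Coend.tmul E (higherExt E X (n + 1)) ξ ε))
    rw [reverse_tmul, reverse_tmul, ih]
    rfl

theorem reverse_surjective (A Z : C) (n : ℕ) : Function.Surjective (reverse E A Z n) := by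
  induction n generalizing A Z with
  | zero => exact fun t => ⟨t, rfl⟩
  | succ n ih =>
    intro t
    induction t using Coend.induction with
    | tmul X ξ δ =>
      obtain ⟨ξ, rfl⟩ := ih X.unop Z ξ
      exact ⟨_, reverse_splice E δ n ξ⟩
    | zero => exact ⟨0, map_zero _⟩
    | add s t hs ht =>
      obtain ⟨s, rfl⟩ := hs
      obtain ⟨t, rfl⟩ := ht
      exact ⟨s + t, map_add _ _ _⟩

end

namespace Extriangulation

variable {C : Type u} [Category.{v} C] [Preadditive C] [HasZeroObject C] [HasBinaryBiproducts C]
variable {𝔼 : Extriangulation C} {M : ObjectProperty C}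

theorem IsRigid.opposite {d : ℕ} (h : 𝔼.IsRigid M d) : 𝔼.opposite.IsRigid M.op d := by
  intro i h1 h2 X Y hX hY
  obtain ⟨n, rfl⟩ : ∃ n, i = n + 1 := ⟨i - 1, by omega⟩
  have := h (n + 1) h1 h2 Y.unop X.unop hY hX
  exact (reverse_surjective 𝔼.E X.unop Y.unop n).subsingleton

/-! ### The dual statements for right indices -/

theorem HasRightIndex.unique (hM : IsAdditiveSubcategory M) {d : ℕ}
    (hV : 𝔼.opposite.LeftVanishing M.op d) {s t : ℕ} (hs : s ≤ d) (ht : t ≤ d)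
    {X : C} {k₁ k₂ : SplitK0 M} (h₁ : 𝔼.HasRightIndex M s X k₁)
    (h₂ : 𝔼.HasRightIndex M t X k₂) : k₁ = k₂ := by
  obtain ⟨k₁, h₁', rfl⟩ := h₁.opposite hM
  obtain ⟨k₂, h₂', rfl⟩ := h₂.opposite hM
  rw [h₁'.unique hM.op hV hs ht h₂']

theorem HasRightIndex.sub_eq_of_natural (hM : IsAdditiveSubcategory M) {d : ℕ} (hd : 1 ≤ d)
    (hV : 𝔼.opposite.LeftVanishing M.op d) {S S₁ : C} {k l k₁ l₁ : SplitK0 M}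
    (hk : 𝔼.HasRightIndex M d S k) (hl : 𝔼.HasLeftIndex M 1 S l)
    (hk₁ : 𝔼.HasRightIndex M d S₁ k₁) (hl₁ : 𝔼.HasLeftIndex M 1 S₁ l₁)
    (φ : ∀ X, M X → (Ext 𝔼.E X S →+ Ext 𝔼.E X S₁))
    (hφ : ∀ X Y (hX : M X) (hY : M Y) (a : Y ⟶ X) ε,
      φ Y hY (pull 𝔼.E a ε) = pull 𝔼.E a (φ X hX ε))
    (hb : ∀ X hX, Function.Bijective (φ X hX)) : k - l = k₁ - l₁ := by
  obtain ⟨k, hk', rfl⟩ := hk.opposite hM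
  obtain ⟨l, hl', rfl⟩ := hl.opposite hM
  obtain ⟨k₁, hk₁', rfl⟩ := hk₁.opposite hM
  obtain ⟨l₁, hl₁', rfl⟩ := hl₁.opposite hM
  rw [← map_sub, ← map_sub, HasLeftIndex.sub_eq_of_natural hM.op hd hV hk' hl' hk₁' hl₁'
    (fun X hX => φ X.unop hX) (fun X Y hX hY a ε => hφ X.unop Y.unop hX hY a.unop ε)
    (fun X hX => hb X.unop hX)]

theorem IsTriangle.exists_rightIndex (hM : IsAdditiveSubcategory M) {d : ℕ} (hd : 1 ≤ d)
    (hV : 𝔼.opposite.LeftVanishing M.op d) {A B Z : C} {f : A ⟶ B} {g : B ⟶ Z}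
    {δ : Ext 𝔼.E Z A} (tri : 𝔼.IsTriangle f g δ) {a b z : SplitK0 M}
    (hA : 𝔼.HasRightIndex M d A a) (hB : 𝔼.HasRightIndex M d B b)
    (hZ : 𝔼.HasRightIndex M d Z z) :
    ∃ (S : C) (k l : SplitK0 M) (c : S ⟶ A), 𝔼.HasRightIndex M d S k ∧
      𝔼.HasLeftIndex M 1 S l ∧ a - b + z = k - l ∧
      ∀ X, M X → Function.Injective (push 𝔼.E c : Ext 𝔼.E X S →+ Ext 𝔼.E X A) ∧
        ∀ ε : Ext 𝔼.E X A, (∃ σ, push 𝔼.E c σ = ε) ↔ ∃ h : X ⟶ Z, pull 𝔼.E h δ = ε := by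
  obtain ⟨a, hA', rfl⟩ := hA.opposite hM
  obtain ⟨b, hB', rfl⟩ := hB.opposite hM
  obtain ⟨z, hZ', rfl⟩ := hZ.opposite hM
  obtain ⟨S, k, l, c, hk, hl, he, hS⟩ :=
    tri.opposite.exists_leftIndex hM.op hd hV hZ' hB' hA'
  refine ⟨S.unop, _, _, c.unop, hk.unop hM, hl.unop hM, ?_, fun X hX => ?_⟩
  · rw [← map_sub, ← map_sub, ← map_add, ← he]
    congr 1; abel
  · obtain ⟨h1, h2⟩ := hS (op X) hX
    refine ⟨h1, fun ε => (h2 ε).trans ⟨?_, ?_⟩⟩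
    · rintro ⟨h, rfl⟩
      exact ⟨h.unop, rfl⟩
    · rintro ⟨h, rfl⟩
      exact ⟨h.op, rfl⟩

end Extriangulation

/-! ### Cokernels of functors to abelian groups -/

section Cokernel

variable {D : Type*} [Category* D] {P Q N W : D ⥤ AddCommGrpCat.{v}}

/-- A pointwise surjective natural transformation whose kernel is pointwise the image of `f` is a
cokernel of `f`. -/
theorem nonempty_cokernel_iso_of_exact (f : P ⟶ Q) (q : Q ⟶ N)
    (hq : ∀ X, Function.Surjective (q.app X).hom)
    (hex : ∀ X y, (q.app X).hom y = 0 ↔ ∃ x, (f.app X).hom x = y) :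
    Nonempty (cokernel f ≅ N) := by
  have hz : ∀ X, f.app X ≫ q.app X = 0 := fun X => by
    ext x
    exact (hex X _).2 ⟨x, rfl⟩
  have hepi : ∀ X, Epi (q.app X) := fun X => (AddCommGrpCat.epi_iff_surjective _).2 (hq X)
  have hlim : ∀ X, IsColimit (CokernelCofork.ofπ (q.app X) (hz X)) := fun X =>
    ShortComplex.Exact.gIsCokernel (S := ShortComplex.mk _ _ (hz X))
      ((ShortComplex.ab_exact_iff _).2 fun y hy => (hex X y).1 hy)
  have : Epi q := NatTrans.epi_of_epi_app q
  have hfac : ∀ {V : D ⥤ AddCommGrpCat.{v}} (k : Q ⟶ V) (hk : f ≫ k = 0) (X : D),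
      q.app X ≫ Cofork.IsColimit.desc (hlim X) (k.app X)
        (by rw [zero_comp, ← NatTrans.comp_app, hk]; rfl) = k.app X :=
    fun k hk X => Cofork.IsColimit.π_desc' (hlim X) _ _
  have hcolim : IsColimit (CokernelCofork.ofπ q (f := f) (by ext X : 2; exact hz X)) :=
    CokernelCofork.IsColimit.ofπ q _
      (fun k hk =>
        { app := fun X => Cofork.IsColimit.desc (hlim X) (k.app X)
            (by rw [zero_comp, ← NatTrans.comp_app, hk]; rfl)
          naturality := fun X Y a => by
            rw [← cancel_epi (q.app X), ← Category.assoc, ← q.naturality, Category.assoc,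
              hfac k hk, ← Category.assoc, hfac k hk, k.naturality] })
      (fun k hk => by ext X : 2; exact hfac k hk X)
      (fun k hk m hm => by
        rw [← cancel_epi q, hm]
        ext X : 2
        exact (hfac k hk X).symm)
  exact ⟨(cokernelIsCokernel f).coconePointUniqueUpToIso hcolim⟩

/-- If `p : Q ⟶ W` has kernel the image of `f` and the same image as the pointwise injective
`i : N ⟶ W`, then `N` is a cokernel of `f`. -/
theorem nonempty_cokernel_iso_of_image (f : P ⟶ Q) (p : Q ⟶ W) (i : N ⟶ W)
    (hi : ∀ X, Function.Injective (i.app X).hom)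
    (hex : ∀ X y, (p.app X).hom y = 0 ↔ ∃ x, (f.app X).hom x = y)
    (him : ∀ X w, (∃ n, (i.app X).hom n = w) ↔ ∃ y, (p.app X).hom y = w) :
    Nonempty (cokernel f ≅ N) := by
  choose r hr using fun X y => (him X ((p.app X).hom y)).2 ⟨y, rfl⟩
  let q : Q ⟶ N :=
    { app := fun X => AddCommGrpCat.ofHom (AddMonoidHom.mk' (r X) fun y y' => hi X (by
        rw [map_add, hr, hr, hr, map_add]))
      naturality := fun X Y a => by
        ext y
        refine hi Y ?_
        have h1 := ConcreteCategory.congr_hom (p.naturality a) y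
        have h2 := ConcreteCategory.congr_hom (i.naturality a) (r X y)
        refine (hr Y _).trans (h1.trans (Eq.trans ?_ h2.symm))
        exact congrArg (W.map a).hom (hr X y).symm }
  refine nonempty_cokernel_iso_of_exact f q (fun X n => ?_) (fun X y => ?_)
  · obtain ⟨y, hy⟩ := (him X _).1 ⟨n, rfl⟩
    exact ⟨y, hi X ((hr X y).trans hy)⟩
  · rw [← hex, ← hr, map_eq_zero_iff _ (hi X)]
    rfl

end Cokernel

/-! ### The modules `E(S, -)`, `E(-, S)` and the cokernels along a triangle -/

namespace Extriangulation

variable {C : Type u} [Category.{v} C] [Preadditive C] [HasZeroObject C] [HasBinaryBiproducts C]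
variable {𝔼 : Extriangulation C} {M : ObjectProperty C}

theorem sub_eq_of_extFrom_iso (hM : IsAdditiveSubcategory M) {d : ℕ} (hd : 1 ≤ d)
    (hV : 𝔼.LeftVanishing M d) {S S₁ : C} {k l k₁ l₁ : SplitK0 M}
    (hk : 𝔼.HasLeftIndex M d S k) (hl : 𝔼.HasRightIndex M 1 S l)
    (hk₁ : 𝔼.HasLeftIndex M d S₁ k₁) (hl₁ : 𝔼.HasRightIndex M 1 S₁ l₁)
    (e : 𝔼.extFrom M S ≅ 𝔼.extFrom M S₁) : k - l = k₁ - l₁ :=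
  HasLeftIndex.sub_eq_of_natural hM hd hV hk hl hk₁ hl₁ (fun X hX => (e.hom.app ⟨X, hX⟩).hom)
    (fun X Y hX hY a ε => ConcreteCategory.congr_hom
      (e.hom.naturality (X := ⟨X, hX⟩) (Y := ⟨Y, hY⟩) (ObjectProperty.homMk a)) ε)
    (fun X hX => ConcreteCategory.bijective_of_isIso (e.hom.app ⟨X, hX⟩))

theorem sub_eq_of_extTo_iso (hM : IsAdditiveSubcategory M) {d : ℕ} (hd : 1 ≤ d)
    (hV : 𝔼.opposite.LeftVanishing M.op d) {S S₁ : C} {k l k₁ l₁ : SplitK0 M}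
    (hk : 𝔼.HasRightIndex M d S k) (hl : 𝔼.HasLeftIndex M 1 S l)
    (hk₁ : 𝔼.HasRightIndex M d S₁ k₁) (hl₁ : 𝔼.HasLeftIndex M 1 S₁ l₁)
    (e : 𝔼.extTo M S ≅ 𝔼.extTo M S₁) : k - l = k₁ - l₁ :=
  HasRightIndex.sub_eq_of_natural hM hd hV hk hl hk₁ hl₁
    (fun X hX => (e.hom.app (op ⟨X, hX⟩)).hom)
    (fun X Y hX hY a ε => ConcreteCategory.congr_hom
      (e.hom.naturality (X := op ⟨X, hX⟩) (Y := op ⟨Y, hY⟩)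
        (Quiver.Hom.op (ObjectProperty.homMk a))) ε)
    (fun X hX => ConcreteCategory.bijective_of_isIso (e.hom.app (op ⟨X, hX⟩)))

theorem IsTriangle.nonempty_cokernel_homFrom_iso {A B Z S : C} {f : A ⟶ B} {g : B ⟶ Z}
    {δ : Ext 𝔼.E Z A} (tri : 𝔼.IsTriangle f g δ) (c : Z ⟶ S)
    (hS : ∀ X, M X → Function.Injective (pull 𝔼.E c : Ext 𝔼.E S X →+ Ext 𝔼.E Z X) ∧
      ∀ ε : Ext 𝔼.E Z X, (∃ σ, pull 𝔼.E c σ = ε) ↔ ∃ h : A ⟶ X, push 𝔼.E h δ = ε) :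
    Nonempty (cokernel ((homFrom M).map f.op) ≅ 𝔼.extFrom M S) :=
  nonempty_cokernel_iso_of_image (W := 𝔼.extFrom M Z) _
    { app := fun X => AddCommGrpCat.ofHom (AddMonoidHom.mk' (fun h : A ⟶ X.obj => push 𝔼.E h δ)
        fun _ _ => 𝔼.push_add_hom _ _ _)
      naturality := fun X Y a => by
        ext h
        exact push_comp 𝔼.E h a.hom δ }
    (Functor.whiskerLeft M.ι (𝔼.E.map c.op))
    (fun X => (hS X.obj X.property).1)
    (fun X h => ⟨fun h0 => tri.exists_extension h h0, by
      rintro ⟨b, rfl⟩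
      exact (push_comp 𝔼.E f b δ).trans
        ((congrArg (push 𝔼.E b) tri.push_eq_zero).trans (map_zero _))⟩)
    (fun X => (hS X.obj X.property).2)

theorem IsTriangle.nonempty_cokernel_homTo_iso {A B Z S : C} {f : A ⟶ B} {g : B ⟶ Z}
    {δ : Ext 𝔼.E Z A} (tri : 𝔼.IsTriangle f g δ) (c : S ⟶ A)
    (hS : ∀ X, M X → Function.Injective (push 𝔼.E c : Ext 𝔼.E X S →+ Ext 𝔼.E X A) ∧
      ∀ ε : Ext 𝔼.E X A, (∃ σ, push 𝔼.E c σ = ε) ↔ ∃ h : X ⟶ Z, pull 𝔼.E h δ = ε) :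
    Nonempty (cokernel ((homTo M).map g) ≅ 𝔼.extTo M S) :=
  nonempty_cokernel_iso_of_image (W := 𝔼.extTo M A) _
    { app := fun X => AddCommGrpCat.ofHom
        (AddMonoidHom.mk' (fun h : X.unop.obj ⟶ Z => pull 𝔼.E h δ)
          fun _ _ => 𝔼.pull_add_hom _ _ _)
      naturality := fun X Y a => by
        ext h
        exact pull_comp 𝔼.E a.unop.hom h δ }
    (Functor.whiskerLeft M.ι.op (𝔼.E.flip.map c))
    (fun X => (hS X.unop.obj X.unop.property).1)
    (fun X h => ⟨fun h0 => tri.exists_coextension h h0, by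
      rintro ⟨b, rfl⟩
      exact (pull_comp 𝔼.E b g δ).trans
        ((congrArg (pull 𝔼.E b) tri.pull_eq_zero).trans (map_zero _))⟩)
    (fun X => (hS X.unop.obj X.unop.property).2)

end Extriangulation

end Extri

theorem proposition3p11 {C : Type u} [Category.{v} C] [Preadditive C] [HasZeroObject C]
    [HasBinaryBiproducts C] (𝔼 : Extri.Extriangulation C) (d : ℕ) (hd : 1 ≤ d)
    (M : ObjectProperty C) (hM : Extri.IsAdditiveSubcategory M) (hrig : 𝔼.IsRigid M d) :
    -- the left and right indices do not depend on the filtration, nor on its length `≤ d`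
    (∀ (X : C) (s t : ℕ), s ≤ d → t ≤ d →
      ∀ (F : 𝔼.LeftFiltration M s X) (G : 𝔼.LeftFiltration M t X), F.altSum = G.altSum) ∧
    (∀ (X : C) (s t : ℕ), s ≤ d → t ≤ d →
      ∀ (F : 𝔼.RightFiltration M s X) (G : 𝔼.RightFiltration M t X), F.altSum = G.altSum) ∧
    -- `Ψ` and `Φ` do not depend on the representing object
    (∀ (N : M.FullSubcategory ⥤ AddCommGrpCat.{v}) (hN : 𝔼.imExtFrom M d N) (S : C)
      (hS : 𝔼.upper M d S) (hS₁ : 𝔼.lower M 1 S), Nonempty (N ≅ 𝔼.extFrom M S) →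
      Extri.Extriangulation.Psi hN =
        Extri.Extriangulation.leftIndex hS - Extri.Extriangulation.rightIndex hS₁) ∧
    (∀ (N : M.FullSubcategoryᵒᵖ ⥤ AddCommGrpCat.{v}) (hN : 𝔼.imExtTo M d N) (S : C)
      (hS : 𝔼.lower M d S) (hS₁ : 𝔼.upper M 1 S), Nonempty (N ≅ 𝔼.extTo M S) →
      Extri.Extriangulation.Phi hN =
        Extri.Extriangulation.rightIndex hS - Extri.Extriangulation.leftIndex hS₁) ∧
    -- the two formulas, for every triangle `A ⟶ B ⟶ Z ⇢`
    (∀ (A B Z : C) (f : A ⟶ B) (g : B ⟶ Z) (δ : Extri.Ext 𝔼.E Z A), 𝔼.IsTriangle f g δ →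
      (∀ (hA : 𝔼.upper M d A) (hB : 𝔼.upper M d B) (hZ : 𝔼.upper M d Z),
        ∃ hN : 𝔼.imExtFrom M d (cokernel ((Extri.Extriangulation.homFrom M).map f.op)),
          Extri.Extriangulation.leftIndex hA - Extri.Extriangulation.leftIndex hB
            + Extri.Extriangulation.leftIndex hZ = Extri.Extriangulation.Psi hN) ∧
      (∀ (hA : 𝔼.lower M d A) (hB : 𝔼.lower M d B) (hZ : 𝔼.lower M d Z),
        ∃ hN : 𝔼.imExtTo M d (cokernel ((Extri.Extriangulation.homTo M).map g)),
          Extri.Extriangulation.rightIndex hA - Extri.Extriangulation.rightIndex hB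
            + Extri.Extriangulation.rightIndex hZ = Extri.Extriangulation.Phi hN)) := by
  have hV := hrig.leftVanishing hM
  have hV' := hrig.opposite.leftVanishing hM.op
  have hΨ : ∀ (N : M.FullSubcategory ⥤ AddCommGrpCat.{v}) (hN : 𝔼.imExtFrom M d N) (S : C)
      (k l : Extri.SplitK0 M), 𝔼.HasLeftIndex M d S k → 𝔼.HasRightIndex M 1 S l →
      Nonempty (N ≅ 𝔼.extFrom M S) → Extri.Extriangulation.Psi hN = k - l :=
    fun N hN S k l hk hl ⟨e⟩ => Extri.Extriangulation.sub_eq_of_extFrom_iso hM hd hV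
      hN.choose_spec.1.hasLeftIndex hN.choose_spec.2.1.hasRightIndex hk hl
      (hN.choose_spec.2.2.some.symm ≪≫ e)
  have hΦ : ∀ (N : M.FullSubcategoryᵒᵖ ⥤ AddCommGrpCat.{v}) (hN : 𝔼.imExtTo M d N) (S : C)
      (k l : Extri.SplitK0 M), 𝔼.HasRightIndex M d S k → 𝔼.HasLeftIndex M 1 S l →
      Nonempty (N ≅ 𝔼.extTo M S) → Extri.Extriangulation.Phi hN = k - l :=
    fun N hN S k l hk hl ⟨e⟩ => Extri.Extriangulation.sub_eq_of_extTo_iso hM hd hV'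
      hN.choose_spec.1.hasRightIndex hN.choose_spec.2.1.hasLeftIndex hk hl
      (hN.choose_spec.2.2.some.symm ≪≫ e)
  refine ⟨fun X s t hs ht F G => F.hasLeftIndex.unique hM hV hs ht G.hasLeftIndex,
    fun X s t hs ht F G => F.hasRightIndex.unique hM hV' hs ht G.hasRightIndex,
    fun N hN S hS hS₁ => hΨ N hN S _ _ hS.hasLeftIndex hS₁.hasRightIndex,
    fun N hN S hS hS₁ => hΦ N hN S _ _ hS.hasRightIndex hS₁.hasLeftIndex,
    fun A B Z f g δ tri => ⟨fun hA hB hZ => ?_, fun hA hB hZ => ?_⟩⟩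
  · obtain ⟨S, k, l, c, hk, hl, he, hS⟩ := tri.exists_leftIndex hM hd hV hA.hasLeftIndex
      hB.hasLeftIndex hZ.hasLeftIndex
    have hiso := tri.nonempty_cokernel_homFrom_iso c hS
    have hN : 𝔼.imExtFrom M d _ := ⟨S, hk.upper, hl.lower, hiso⟩
    exact ⟨hN, he.trans (hΨ _ hN S k l hk hl hiso).symm⟩
  · obtain ⟨S, k, l, c, hk, hl, he, hS⟩ := tri.exists_rightIndex hM hd hV' hA.hasRightIndex
      hB.hasRightIndex hZ.hasRightIndex
    have hiso := tri.nonempty_cokernel_homTo_iso c hS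
    have hN : 𝔼.imExtTo M d _ := ⟨S, hk.lower, hl.upper, hiso⟩
    exact ⟨hN, he.trans (hΦ _ hN S k l hk hl hiso).symm⟩
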